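/- Let $C=\{T,F,U\}$ carry the operations - negation: $T'=F$, $F'=T$, $U'=U$; - conjunction: $T\wedge y=y$, $F\wedge y=F$, $U\wedge y=U$; - disjunction: $T\vee y=T$, $F\vee y=y$, $U\vee y=U$. Consider the equations (1.1a) $x''=x$, (1.1b) $(x\wedge y)'=x'\vee y'$, (1.1c) $(x\wedge y)\wedge z=x\wedge(y\wedge z)$, (1.1d) $x\wedge(y\vee z)=(x\wedge y)\vee(x\wedge z)$, (1.1e) $(x\vee y)\wedge z=(x\wedge z)\vee(x'\wedge y\wedge z)$, (1.1f) $x\vee(x\wedge y)=x$, (1.1g) $(x\wedge y)\vee(y\wedge x)=(y\wedge x)\vee(x\wedge y)$, the two readings of (1.1e) (Mem1) $(x\vee y)\wedge z=(x\wedge z)\vee(x'\wedge(y\wedge z))$, (Mem2) $(x\vee y)\wedge z=(x\wedge z)\vee((x'\wedge y)\wedge z)$, and the equations for constants (1.4a) $U'=U$, (1.4b) $T\wedge x=x$, (1.4c) $T'=F$. For each of the four choices of distinguished constants $K\in\{\emptyset,\{T,F\},\{U\},\{T,F,U\}\}$, terms are built from countably many variables and the constants in $K$ with $'$, $\wedge$,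 $\vee$, and $\vdash$ denotes derivability in equational logic. Let $E_K$ be, respectively, $\emptyset$, $\{(1.4b),(1.4c)\}$, $\{(1.4a)\}$, $\{(1.4a),(1.4b),(1.4c)\}$. A set $\Gamma$ of equations *completely axiomatises* conditional logic with $K$ distinguished if, for all terms $s,t$, the following are equivalent: $\Gamma\vdash s=t$; the equation $s=t$ is valid in $C$, each constant denoting the corresponding element; and $s=t$ is derivable from (1.1a)–(1.1g) together with $E_K$, under either reading of (1.1e). A set $\Gamma$ of equations is *independent* if no $e\in\Gamma$ is derivable from $\Gamma\setminus\{e\}$. **Theorem.** The Guzmán–Squier axioms (1.1a)–(1.1g) are not independent, under either reading of (1.1e). Moreover: (i) Conditional logic with no distinguished constants is completely axiomatised by $\{(1.1a),(1.1b),(\mathrm{Mem1}),(1.1f),(1.1g)\}$, and this set is independent. (ii) Conditional logic with no distinguished constants is completely axiomatised by $\{(1.1a),(1.1b),(1.1d),(\mathrm{Mem2}),(1.1f),(1.1g)\}$, and this set is independent. (iii) Conditional logic with only $T$ and $F$ distinguished is completely axiomatised by (1.4b), (1.4c) together with the axioms in (i), and also by (1.4b), (1.4c) together with those in (ii). Each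 of these two sets is independent. (iv) Conditional logic with only $U$ distinguished is completely axiomatised by (1.4a) together with the axioms in (i), and also by (1.4a) together with those in (ii). Each of these two sets is independent. (v) Conditional logic with $T$, $F$ and $U$ distinguished is completely axiomatised by (1.4a), (1.4b), (1.4c) together with the axioms in (i), and also by (1.4a), (1.4b), (1.4c) together with those in (ii). Each of these two sets is independent. -/

import Mathlib

namespace CondLogic

/-- The three truth values, i.e. the carrier of the algebra `C`. -/
inductive C : Type
  | T : C
  | F : C
  | U : C

namespace C

/-- Negation `'` on `C`. -/
def neg : C → C
  | T => F
  | F => T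
  | U => U

/-- Conjunction on `C`; the left argument is evaluated first. -/
def and : C → C → C
  | T, y => y
  | F, _ => F
  | U, _ => U

/-- Disjunction on `C`; the left argument is evaluated first. -/
def or : C → C → C
  | T, _ => T
  | F, y => y
  | U, _ => U

end C

/-- Open terms over the operations `'`, `∧`, `∨`, countably many variables, and one constant symbol
for each distinguished truth value, i.e. each element of `K`. -/
inductive Term (K : Set C) : Type
  | var (n : ℕ) : Term K
  | const (c : C) (hc : c ∈ K) : Term K
  | neg (s : Term K) : Term K
  | and (s t : Term K) : Term K
  | or (s t : Term K) : Term K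

namespace Term

/-- Simultaneous substitution of terms for the variables. -/
def subst {K : Set C} (σ : ℕ → Term K) : Term K → Term K
  | var n => σ n
  | const c hc => const c hc
  | neg s => neg (s.subst σ)
  | and s t => and (s.subst σ) (t.subst σ)
  | or s t => or (s.subst σ) (t.subst σ)

/-- The value of a term in the algebra `C` under a valuation of the variables; the constant symbol
of a distinguished truth value denotes this truth value. -/
def eval {K : Set C} (v : ℕ → C) : Term K → C
  | var n => v n
  | const c _ => c
  | neg s => C.neg (s.eval v)
  | and s t => C.and (s.eval v) (t.eval v)
  | or s t => C.or (s.eval v) (t.eval v)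

end Term

/-- An equation `lhs = rhs` between open terms. -/
structure Equation (K : Set C) : Type where
  lhs : Term K
  rhs : Term K

/-- `Derives Γ s t`: the equation `s = t` is derivable from the set of equations `Γ` in equational
logic. -/
inductive Derives {K : Set C} (Γ : Set (Equation K)) : Term K → Term K → Prop
  | ax (e : Equation K) (he : e ∈ Γ) (σ : ℕ → Term K) : Derives Γ (e.lhs.subst σ) (e.rhs.subst σ)
  | refl (s : Term K) : Derives Γ s s
  | symm {s t : Term K} : Derives Γ s t → Derives Γ t s
  | trans {s t u : Term K} : Derives Γ s t → Derives Γ t u → Derives Γ s u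
  | neg {s t : Term K} : Derives Γ s t → Derives Γ s.neg t.neg
  | and {s s₁ t t₁ : Term K} :
      Derives Γ s s₁ → Derives Γ t t₁ → Derives Γ (s.and t) (s₁.and t₁)
  | or {s s₁ t t₁ : Term K} :
      Derives Γ s s₁ → Derives Γ t t₁ → Derives Γ (s.or t) (s₁.or t₁)

/-- Validity of the equation `s = t` in the algebra `C` with the elements of `K` distinguished. -/
def ValidInC {K : Set C} (s t : Term K) : Prop :=
  ∀ v : ℕ → C, s.eval v = t.eval v

/-- No equation of `Γ` is derivable from the other equations of `Γ`. -/
def Independent {K : Set C} (Γ : Set (Equation K)) : Prop :=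
  ∀ e ∈ Γ, ¬ Derives (Γ \ {e}) e.lhs e.rhs

section Axioms

variable {K : Set C}

/-- The variable `x`. -/
def x : Term K := .var 0
/-- The variable `y`. -/
def y : Term K := .var 1
/-- The variable `z`. -/
def z : Term K := .var 2

/-- `x'' = x` -/
def ax1a : Equation K := ⟨x.neg.neg, x⟩

/-- `(x ∧ y)' = x' ∨ y'` -/
def ax1b : Equation K := ⟨(x.and y).neg, x.neg.or y.neg⟩

/-- `(x ∧ y) ∧ z = x ∧ (y ∧ z)` -/
def ax1c : Equation K := ⟨(x.and y).and z, x.and (y.and z)⟩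

/-- `x ∧ (y ∨ z) = (x ∧ y) ∨ (x ∧ z)` -/
def ax1d : Equation K := ⟨x.and (y.or z), (x.and y).or (x.and z)⟩

/-- `(x ∨ y) ∧ z = (x ∧ z) ∨ (x' ∧ (y ∧ z))`, the first reading of axiom (1.1e) -/
def mem1 : Equation K := ⟨(x.or y).and z, (x.and z).or (x.neg.and (y.and z))⟩

/-- `(x ∨ y) ∧ z = (x ∧ z) ∨ ((x' ∧ y) ∧ z)`, the second reading of axiom (1.1e) -/
def mem2 : Equation K := ⟨(x.or y).and z, (x.and z).or ((x.neg.and y).and z)⟩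

/-- `x ∨ (x ∧ y) = x` -/
def ax1f : Equation K := ⟨x.or (x.and y), x⟩

/-- `(x ∧ y) ∨ (y ∧ x) = (y ∧ x) ∨ (x ∧ y)` -/
def ax1g : Equation K := ⟨(x.and y).or (y.and x), (y.and x).or (x.and y)⟩

/-- `U' = U` -/
def ax4a (hU : C.U ∈ K) : Equation K := ⟨(Term.const C.U hU).neg, Term.const C.U hU⟩

/-- `T ∧ x = x` -/
def ax4b (hT : C.T ∈ K) : Equation K := ⟨(Term.const C.T hT).and x, x⟩

/-- `T' = F` -/
def ax4c (hT : C.T ∈ K) (hF : C.F ∈ K) : Equation K :=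
  ⟨(Term.const C.T hT).neg, Term.const C.F hF⟩

end Axioms

/-- The seven Guzmán–Squier axioms (1.1a–g), with (1.1e) read as `mem1`. -/
def guzmanSquier1 (K : Set C) : Set (Equation K) :=
  {ax1a, ax1b, ax1c, ax1d, mem1, ax1f, ax1g}

/-- The seven Guzmán–Squier axioms (1.1a–g), with (1.1e) read as `mem2`. -/
def guzmanSquier2 (K : Set C) : Set (Equation K) :=
  {ax1a, ax1b, ax1c, ax1d, mem2, ax1f, ax1g}

/-- The five axioms (1.1a), (1.1b), (Mem1), (1.1f), (1.1g). -/
def fiveAxioms (K : Set C) : Set (Equation K) :=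
  {ax1a, ax1b, mem1, ax1f, ax1g}

/-- The six axioms (1.1a), (1.1b), (1.1d), (Mem2), (1.1f), (1.1g). -/
def sixAxioms (K : Set C) : Set (Equation K) :=
  {ax1a, ax1b, ax1d, mem2, ax1f, ax1g}

/-- The distinguished constants `T` and `F`. -/
def constTF : Set C := {C.T, C.F}

theorem T_mem_constTF : C.T ∈ constTF := Or.inl rfl

theorem F_mem_constTF : C.F ∈ constTF := Or.inr rfl

/-- The distinguished constant `U`. -/
def constU : Set C := {C.U}

theorem U_mem_constU : C.U ∈ constU := rfl

/-- The axioms (1.4b), (1.4c) for `T` and `F` distinguished. -/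
def axiomsTF : Set (Equation constTF) :=
  {ax4b T_mem_constTF, ax4c T_mem_constTF F_mem_constTF}

/-- The axiom (1.4a) for `U` distinguished. -/
def axiomsU : Set (Equation constU) :=
  {ax4a U_mem_constU}

/-- The axioms (1.4a), (1.4b), (1.4c) for `T`, `F` and `U` distinguished. -/
def axiomsTFU : Set (Equation Set.univ) :=
  {ax4a (Set.mem_univ _), ax4b (Set.mem_univ _), ax4c (Set.mem_univ _) (Set.mem_univ _)}

/-- Conditional logic with the elements of `K` distinguished, where `E` is the set of axioms for
these constants, is completely axiomatised by `Γ`: derivability from `Γ` coincides with validity in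
`C`, and also with derivability from the Guzmán–Squier axioms extended with `E`, under either
reading of (1.1e). -/
def CompletelyAxiomatisesCL {K : Set C} (E Γ : Set (Equation K)) : Prop :=
  ∀ s t : Term K,
    (Derives Γ s t ↔ ValidInC s t) ∧
    (Derives Γ s t ↔ Derives (guzmanSquier1 K ∪ E) s t) ∧
    (Derives Γ s t ↔ Derives (guzmanSquier2 K ∪ E) s t)

end CondLogic

/-!
Each of the two axiom sets without constants is self-dual under exchanging `∧` and `∨`, and forces
associativity and left distributivity, so its models are the C-algebras of Guzmán and Squier. In a
C-algebra write `dom a = a ∨ a'` and `branch a b c = (a ∧ b) ∨ (a' ∧ c)`; an element `y` that does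
not change when `a` is tested first, `dom a ∧ y = y`, is determined by `a ∧ y` and `a' ∧ y`. If `T`
is available, every term is therefore the value of a binary decision tree over its variables, and
pulling the variables to the root one after the other shows that a tree is determined by its values
in `C`. If `T` is not available, fresh elements for truth and falsity can be adjoined to any
C-algebra without disturbing the laws. Applied to the algebra of terms modulo provable equality,
this is completeness. Independence is witnessed by finite models.
-/

namespace CondLogic

/-- An algebra satisfying (1.1a), (1.1b), (1.1f) and (1.1g), the axioms common to both
axiomatisations; negation, conjunction and disjunction are written `ᶜ`, `⊓` and `⊔`. -/
class PreCAlgebra (A : Type*) extends Compl A, Min A, Max A where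
  compl_compl (x : A) : xᶜᶜ = x
  compl_inf (x y : A) : (x ⊓ y)ᶜ = xᶜ ⊔ yᶜ
  sup_inf_self (x y : A) : x ⊔ (x ⊓ y) = x
  inf_sup_inf_comm (x y : A) : (x ⊓ y) ⊔ (y ⊓ x) = (y ⊓ x) ⊔ (x ⊓ y)

/-- A C-algebra in the sense of Guzmán and Squier, presented by the five axioms of (i). -/
class CAlgebra (A : Type*) extends PreCAlgebra A where
  inf_sup_right (x y z : A) : (x ⊔ y) ⊓ z = (x ⊓ z) ⊔ (xᶜ ⊓ (y ⊓ z))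

/-- A C-algebra presented by the six axioms of (ii). -/
class DistribCAlgebra (A : Type*) extends PreCAlgebra A where
  inf_sup_left (x y z : A) : x ⊓ (y ⊔ z) = (x ⊓ y) ⊔ (x ⊓ z)
  inf_sup_right (x y z : A) : (x ⊔ y) ⊓ z = (x ⊓ z) ⊔ ((xᶜ ⊓ y) ⊓ z)

section PreCAlgebra

variable {A : Type*} [PreCAlgebra A]

theorem compl_compl (x : A) : xᶜᶜ = x := PreCAlgebra.compl_compl x

theorem compl_inf (x y : A) : (x ⊓ y)ᶜ = xᶜ ⊔ yᶜ := PreCAlgebra.compl_inf x y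

theorem compl_sup (x y : A) : (x ⊔ y)ᶜ = xᶜ ⊓ yᶜ := by
  rw [← compl_compl (xᶜ ⊓ yᶜ), compl_inf, compl_compl, compl_compl]

theorem sup_inf_self (x y : A) : x ⊔ (x ⊓ y) = x := PreCAlgebra.sup_inf_self x y

theorem inf_sup_inf_comm (x y : A) : (x ⊓ y) ⊔ (y ⊓ x) = (y ⊓ x) ⊔ (x ⊓ y) :=
  PreCAlgebra.inf_sup_inf_comm x y

theorem compl_injective : Function.Injective (compl : A → A) :=
  Function.LeftInverse.injective compl_compl

theorem inf_sup_self (x y : A) : x ⊓ (x ⊔ y) = x :=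
  compl_injective (by rw [compl_inf, compl_sup, sup_inf_self])

theorem sup_inf_sup_comm (x y : A) : (x ⊔ y) ⊓ (y ⊔ x) = (y ⊔ x) ⊓ (x ⊔ y) :=
  compl_injective (by simp only [compl_inf, compl_sup, inf_sup_inf_comm])

-- The axioms are self-dual, so that the dual of a lemma `h` is `h (A := Aᵒᵈ)`.
instance : PreCAlgebra Aᵒᵈ where
  compl x := OrderDual.toDual (OrderDual.ofDual x)ᶜ
  compl_compl := compl_compl (A := A)
  compl_inf := compl_sup (A := A)
  sup_inf_self := inf_sup_self (A := A)
  inf_sup_inf_comm := sup_inf_sup_comm (A := A)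

theorem inf_idem (x : A) : x ⊓ x = x := by
  nth_rw 2 [← sup_inf_self x x]
  rw [inf_sup_self]

theorem sup_idem (x : A) : x ⊔ x = x := inf_idem (A := Aᵒᵈ) x

theorem inf_compl_comm_of_sup_eq (h : ∀ x : A, (x ⊓ xᶜ) ⊔ (xᶜ ⊓ x) = x ⊓ xᶜ) (x : A) :
    x ⊓ xᶜ = xᶜ ⊓ x := by
  rw [← h x, inf_sup_inf_comm]
  simpa only [compl_compl] using h xᶜ

end PreCAlgebra

namespace CAlgebra

variable {A : Type*} [CAlgebra A]

theorem sup_inf_right (x y z : A) : (x ⊓ y) ⊔ z = (x ⊔ z) ⊓ (xᶜ ⊔ (y ⊔ z)) :=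
  compl_injective (by
    rw [compl_sup, compl_inf, inf_sup_right, compl_inf, compl_sup, compl_sup, compl_sup])

instance : CAlgebra Aᵒᵈ where
  inf_sup_right := sup_inf_right (A := A)

theorem inf_compl_comm (x : A) : x ⊓ xᶜ = xᶜ ⊓ x := by
  have h (x : A) : (x ⊓ xᶜ) ⊔ (xᶜ ⊓ x) = x ⊓ xᶜ :=
    calc (x ⊓ xᶜ) ⊔ (xᶜ ⊓ x)
        = ((x ⊓ x) ⊔ (xᶜ ⊓ (x ⊓ x))) ⊓ xᶜ := by
          rw [sup_inf_right, sup_inf_self, sup_idem, inf_idem]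
      _ = x ⊓ xᶜ := by rw [← inf_sup_right, sup_idem, inf_idem]
  exact inf_compl_comm_of_sup_eq h x

theorem sup_compl_comm (x : A) : x ⊔ xᶜ = xᶜ ⊔ x := inf_compl_comm (A := Aᵒᵈ) x

theorem inf_compl_inf (x y : A) : x ⊓ (xᶜ ⊓ y) = x ⊓ xᶜ :=
  calc x ⊓ (xᶜ ⊓ y)
      = x ⊓ (xᶜ ⊔ ((xᶜ ⊓ y) ⊔ (x ⊓ (xᶜ ⊓ y)))) := by
        nth_rw 1 [← sup_idem (x ⊓ (xᶜ ⊓ y))]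
        rw [sup_inf_right, sup_inf_self]
    _ = x ⊓ (xᶜ ⊔ ((xᶜ ⊔ xᶜ) ⊓ y)) := by rw [inf_sup_right, compl_compl]
    _ = x ⊓ xᶜ := by rw [sup_idem, sup_inf_self]

theorem sup_compl_sup (x y : A) : x ⊔ (xᶜ ⊔ y) = x ⊔ xᶜ := inf_compl_inf (A := Aᵒᵈ) x y

theorem compl_inf_inf (x y : A) : xᶜ ⊓ (x ⊓ y) = x ⊓ xᶜ := by
  have h := inf_compl_inf xᶜ y
  rwa [compl_compl, ← inf_compl_comm] at h

theorem inf_sup_inf_compl (x y : A) : (x ⊓ y) ⊔ (x ⊓ xᶜ) = x ⊓ y := by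
  rw [← compl_inf_inf x y, ← inf_sup_right, sup_idem]

theorem sup_inf_sup_compl (x y : A) : (x ⊔ y) ⊓ (x ⊔ xᶜ) = x ⊔ y :=
  inf_sup_inf_compl (A := Aᵒᵈ) x y

theorem sup_compl_inf_self (x : A) : (x ⊔ xᶜ) ⊓ x = x := by
  rw [inf_sup_right, inf_idem, ← inf_compl_comm, compl_inf_inf, sup_inf_self]

theorem inf_compl_sup_self (x : A) : (x ⊓ xᶜ) ⊔ x = x := sup_compl_inf_self (A := Aᵒᵈ) x

theorem inf_inf_compl (x : A) : x ⊓ (x ⊓ xᶜ) = x ⊓ xᶜ := by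
  rw [inf_compl_comm, inf_compl_inf, inf_compl_comm]

theorem sup_compl_inf_inf_self_left (x y : A) : (x ⊔ xᶜ) ⊓ (x ⊓ y) = x ⊓ (x ⊓ y) := by
  rw [inf_sup_right, compl_inf_inf, compl_inf_inf, inf_sup_inf_compl]

theorem inf_compl_sup_sup_self_left (x y : A) : (x ⊓ xᶜ) ⊔ (x ⊔ y) = x ⊔ (x ⊔ y) :=
  sup_compl_inf_inf_self_left (A := Aᵒᵈ) x y

theorem inf_compl_sup_inf (x y : A) : x ⊓ (xᶜ ⊔ (x ⊓ y)) = x ⊓ (x ⊓ y) := by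
  have h := sup_inf_right x (x ⊓ y) (x ⊓ xᶜ)
  rw [sup_inf_self, inf_sup_inf_compl, inf_sup_inf_compl] at h
  exact h.symm

theorem inf_eq_left_of_inf_compl_eq {w : A} (h : w ⊓ wᶜ = w) (y : A) : w ⊓ y = w := by
  have h_compl : wᶜ ⊓ w = w := by rw [← inf_compl_comm, h]
  have h_sup_compl : w ⊔ wᶜ = wᶜ := by
    simpa only [compl_inf, compl_compl, ← sup_compl_comm] using congrArg compl h
  have h_sup (y : A) : (w ⊓ y) ⊔ w = w ⊓ y := by
    simpa only [h] using inf_sup_inf_compl w y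
  have h_inf (y : A) : (wᶜ ⊔ y) ⊓ w = w := by
    rw [inf_sup_right, h_compl, compl_compl, sup_inf_self]
  have h_sup_inf : ((w ⊓ y) ⊓ w) ⊔ w = (w ⊓ y) ⊓ w := by
    have h' := inf_sup_right (w ⊓ y) w w
    rwa [h_sup, inf_idem, compl_inf, h_inf, eq_comm] at h'
  have h_inf_inf : (w ⊓ y) ⊓ w = w := by
    have h' := inf_sup_right (w ⊓ y) wᶜ w
    rw [h_compl, compl_inf, h_inf, h_sup_inf] at h'
    rw [← h', sup_inf_right, h_sup_compl, inf_sup_self, h_compl]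
  calc w ⊓ y
      = ((w ⊓ y) ⊓ ((wᶜ ⊔ yᶜ) ⊓ w)) ⊔ (w ⊓ y) := by
        rw [← compl_inf, inf_compl_inf, inf_compl_sup_self]
    _ = w := by rw [h_inf, h_inf_inf, sup_inf_self]

theorem inf_compl_self_inf (x y : A) : (x ⊓ xᶜ) ⊓ y = x ⊓ xᶜ := by
  refine inf_eq_left_of_inf_compl_eq ?_ y
  calc (x ⊓ xᶜ) ⊓ (x ⊓ xᶜ)ᶜ
      = (x ⊓ xᶜ) ⊓ ((x ⊔ xᶜ) ⊓ x) := by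
        rw [← inf_compl_inf _ x, compl_inf, compl_compl, sup_compl_comm]
    _ = (x ⊓ xᶜ) ⊓ ((x ⊓ xᶜ) ⊔ x) := by rw [sup_compl_inf_self, inf_compl_sup_self]
    _ = x ⊓ xᶜ := inf_sup_self _ _

theorem sup_compl_self_sup (x y : A) : (x ⊔ xᶜ) ⊔ y = x ⊔ xᶜ :=
  inf_compl_self_inf (A := Aᵒᵈ) x y

theorem sup_compl_inf_sup_sup (x y : A) : (x ⊔ xᶜ) ⊓ (x ⊔ (x ⊔ y)) = x ⊔ y :=
  calc (x ⊔ xᶜ) ⊓ (x ⊔ (x ⊔ y))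
      = ((x ⊔ xᶜ) ⊔ y) ⊓ ((x ⊔ xᶜ)ᶜ ⊔ (x ⊔ y)) := by
        rw [sup_compl_self_sup, compl_sup, compl_compl, ← inf_compl_comm,
          inf_compl_sup_sup_self_left]
    _ = x ⊔ y := by rw [← sup_inf_right, sup_compl_inf_self]

theorem inf_inf_self_left (x y : A) : x ⊓ (x ⊓ y) = x ⊓ y := by
  have h : (x ⊓ xᶜ) ⊔ (x ⊓ (x ⊓ y)) = x ⊓ y := sup_compl_inf_sup_sup (A := Aᵒᵈ) x y
  calc x ⊓ (x ⊓ y)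
      = (x ⊔ (x ⊓ (x ⊓ y))) ⊓ (xᶜ ⊔ ((x ⊓ xᶜ) ⊔ (x ⊓ (x ⊓ y)))) := by
        rw [sup_inf_self, h, inf_compl_sup_inf]
    _ = x ⊓ y := by rw [← sup_inf_right, inf_inf_compl, h]

theorem sup_compl_inf_inf (x y : A) : (x ⊔ xᶜ) ⊓ (x ⊓ y) = x ⊓ y := by
  rw [sup_compl_inf_inf_self_left, inf_inf_self_left]

theorem inf_compl_sup_inf_left (x y : A) : (x ⊓ xᶜ) ⊔ (x ⊓ y) = x ⊓ y := by
  have h : (x ⊓ xᶜ) ⊔ (x ⊓ (x ⊓ y)) = x ⊓ y := sup_compl_inf_sup_sup (A := Aᵒᵈ) x y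
  rwa [inf_inf_self_left] at h

theorem compl_sup_inf_self (x y : A) : (xᶜ ⊔ y) ⊓ x = x ⊓ (y ⊓ x) := by
  rw [inf_sup_right, compl_compl, ← inf_compl_comm, inf_compl_sup_inf_left]

theorem inf_sup_compl_self (x y : A) : (x ⊓ y) ⊔ xᶜ = xᶜ ⊔ (y ⊔ xᶜ) := by
  have h : (xᶜᶜ ⊓ y) ⊔ xᶜ = xᶜ ⊔ (y ⊔ xᶜ) := compl_sup_inf_self (A := Aᵒᵈ) xᶜ y
  rwa [compl_compl] at h

theorem inf_sup_compl_inf_self (x y : A) : x ⊓ ((y ⊔ xᶜ) ⊓ x) = (x ⊓ y) ⊓ x :=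
  calc x ⊓ ((y ⊔ xᶜ) ⊓ x)
      = ((x ⊓ y) ⊔ xᶜ) ⊓ x := by rw [← compl_sup_inf_self, inf_sup_compl_self]
    _ = ((x ⊓ y) ⊔ (x ⊓ xᶜ)) ⊓ x := by
      rw [inf_sup_right, inf_sup_right, inf_compl_self_inf, inf_compl_comm]
    _ = (x ⊓ y) ⊓ x := by rw [inf_sup_inf_compl]

theorem inf_inf_self (x y : A) : (x ⊓ y) ⊓ x = x ⊓ y := by
  have h : ((x ⊓ y) ⊓ x) ⊔ (x ⊓ y) = x ⊓ y := by
    have h := inf_sup_inf_comm (x ⊓ y) x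
    rwa [inf_inf_self_left, sup_inf_self] at h
  calc (x ⊓ y) ⊓ x
      = ((x ⊓ y) ⊓ x) ⊓ (((x ⊓ y) ⊓ x) ⊔ (x ⊓ y)) := by rw [inf_sup_self]
    _ = (x ⊓ y) ⊓ ((x ⊔ (x ⊓ y)ᶜ) ⊓ (x ⊓ y)) := by rw [h, inf_sup_compl_inf_self]
    _ = x ⊓ y := by rw [compl_inf, sup_compl_sup, sup_compl_inf_inf, inf_idem]

theorem inf_sup_compl_inf (x y : A) : x ⊓ ((y ⊔ xᶜ) ⊓ x) = x ⊓ y := by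
  rw [inf_sup_compl_inf_self, inf_inf_self]

theorem inf_compl_sup_eq_inf_inf (x y : A) : x ⊓ (xᶜ ⊔ y) = x ⊓ (y ⊓ x) := by
  have h : (xᶜ ⊔ y) ⊔ xᶜ = xᶜ ⊔ y := inf_inf_self (A := Aᵒᵈ) xᶜ y
  rw [← inf_sup_compl_inf, h, compl_sup_inf_self, inf_inf_self_left]

theorem sup_inf_self_right (x y : A) : (x ⊔ y) ⊓ y = (x ⊔ xᶜ) ⊓ y := by
  rw [inf_sup_right, inf_sup_right, inf_idem, inf_inf_self_left]

theorem inf_sup_self_right (x y : A) : (x ⊓ y) ⊔ y = (x ⊓ xᶜ) ⊔ y :=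
  sup_inf_self_right (A := Aᵒᵈ) x y

theorem inf_sup_inf (x y z : A) : (x ⊓ y) ⊔ (x ⊓ z) = x ⊓ ((y ⊔ (x ⊓ z)) ⊓ x) := by
  rw [sup_inf_right, sup_inf_self, inf_compl_sup_eq_inf_inf]

theorem inf_sup_compl_inf_left (x y : A) : x ⊓ ((x ⊔ xᶜ) ⊓ y) = x ⊓ y := by
  have h (y : A) : x ⊓ (((x ⊔ xᶜ) ⊓ y) ⊓ x) = x ⊓ y := by
    rw [sup_compl_comm, inf_sup_right, compl_compl, ← inf_sup_inf, inf_compl_inf,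
      inf_inf_self_left, inf_compl_sup_inf_left]
  rw [← h, inf_inf_self_left, h]

theorem inf_inf_self_right (x y : A) : (x ⊓ y) ⊓ y = x ⊓ y := by
  have h : (x ⊓ xᶜ) ⊔ (x ⊓ xᶜ)ᶜ = x ⊔ xᶜ := by
    rw [sup_compl_comm, compl_inf, compl_compl, ← sup_compl_comm, sup_compl_self_sup]
  calc (x ⊓ y) ⊓ y
      = (x ⊓ y) ⊓ (((x ⊓ xᶜ) ⊔ y) ⊓ y) := by
        rw [← inf_sup_compl_inf_left, ← sup_inf_self_right, inf_sup_self_right]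
    _ = (x ⊓ y) ⊓ ((x ⊓ y) ⊔ (xᶜ ⊓ (xᶜ ⊓ y))) := by rw [sup_inf_self_right, h, inf_sup_right]
    _ = x ⊓ y := inf_sup_self _ _

theorem compl_sup_inf_inf (x y z : A) : (xᶜ ⊔ y) ⊓ (x ⊓ z) = x ⊓ (y ⊓ (x ⊓ z)) := by
  rw [inf_sup_right, compl_compl, compl_inf_inf, inf_compl_sup_inf_left]

theorem compl_inf_compl_inf_self (x y : A) : xᶜ ⊓ (yᶜ ⊓ x) = xᶜ ⊓ (y ⊓ x) := by
  have h (y : A) : xᶜ ⊓ ((y ⊔ x) ⊓ xᶜ) = xᶜ ⊓ y := by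
    simpa only [compl_compl] using inf_sup_compl_inf xᶜ y
  rw [← h, inf_sup_self_right, compl_compl, ← inf_compl_comm, ← inf_sup_self_right, h]

theorem sup_compl_inf (x y : A) : (x ⊔ yᶜ) ⊓ x = (x ⊔ y) ⊓ x := by
  rw [inf_sup_right, compl_inf_compl_inf_self, ← inf_sup_right]

theorem inf_sup_self_inf (x y : A) : ((x ⊓ y) ⊔ x) ⊓ y = x ⊓ y := by
  rw [inf_sup_right, inf_inf_self_right, ← inf_compl_comm, sup_inf_self]

theorem inf_inf_inf_self (x y : A) : x ⊓ (y ⊓ (x ⊓ y)) = x ⊓ y := by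
  have h_inf : x ⊓ ((xᶜ ⊔ y) ⊓ y) = x ⊓ y := by
    rw [sup_inf_self_right, compl_compl, ← sup_compl_comm, inf_sup_compl_inf_left]
  have h_sup : (x ⊓ yᶜ) ⊔ x = (x ⊓ y) ⊔ x := sup_compl_inf (A := Aᵒᵈ) x y
  calc x ⊓ (y ⊓ (x ⊓ y))
      = (xᶜ ⊔ y) ⊓ (x ⊓ ((xᶜ ⊔ y) ⊓ y)) := by rw [← compl_sup_inf_inf, h_inf]
    _ = ((xᶜ ⊔ y)ᶜ ⊔ x) ⊓ ((xᶜ ⊔ y) ⊓ y) := (compl_sup_inf_inf _ _ _).symm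
    _ = ((x ⊓ ((xᶜ ⊔ y) ⊓ y)) ⊔ x) ⊓ ((xᶜ ⊔ y) ⊓ y) := by
      rw [compl_sup, compl_compl, h_sup, h_inf]
    _ = x ⊓ y := by rw [inf_sup_self_inf, h_inf]

theorem inf_inf_sup_compl (x y : A) : x ⊓ (y ⊓ (x ⊔ xᶜ)) = x ⊓ (y ⊓ x) := by
  have h_inf_sup : (xᶜ ⊔ y) ⊓ (xᶜ ⊔ x) = xᶜ ⊔ ((y ⊓ (xᶜ ⊔ x)) ⊔ xᶜ) :=
    inf_sup_inf (A := Aᵒᵈ) xᶜ y x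
  have h_sup : (xᶜ ⊔ y) ⊓ (xᶜ ⊔ x) = xᶜ ⊔ y := by
    simpa only [compl_compl] using sup_inf_sup_compl xᶜ y
  rw [sup_compl_comm, ← inf_sup_compl_inf, ← compl_sup_inf_self, ← h_inf_sup, h_sup,
    compl_sup_inf_self]

theorem inf_inf_cancel (x y : A) : x ⊓ (y ⊓ x) = x ⊓ y :=
  calc x ⊓ (y ⊓ x)
      = x ⊓ (y ⊓ ((x ⊔ xᶜ) ⊓ y)) := by
        rw [← inf_inf_sup_compl, ← inf_sup_compl_inf y, sup_compl_self_sup]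
    _ = x ⊓ ((x ⊔ xᶜ) ⊓ (y ⊓ ((x ⊔ xᶜ) ⊓ y))) := (inf_sup_compl_inf_left _ _).symm
    _ = x ⊓ y := by rw [inf_inf_inf_self, inf_sup_compl_inf_left]

theorem inf_compl_sup (x y : A) : x ⊓ (xᶜ ⊔ y) = x ⊓ y := by
  rw [inf_compl_sup_eq_inf_inf, inf_inf_cancel]

theorem inf_compl_sup_inf_right (x y z : A) : x ⊓ ((xᶜ ⊔ y) ⊓ z) = x ⊓ (y ⊓ z) := by
  rw [← inf_inf_cancel, inf_sup_right, compl_compl, ← inf_sup_inf, inf_compl_inf,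
    inf_compl_sup_inf_left]

theorem inf_inf_inf_self_left (x y z : A) : x ⊓ ((x ⊓ y) ⊓ z) = (x ⊓ y) ⊓ z := by
  have h_sup : (x ⊓ xᶜ) ⊔ ((x ⊓ xᶜ)ᶜ ⊓ ((x ⊓ y) ⊓ z)) = (x ⊓ xᶜ) ⊔ ((x ⊓ y) ⊓ z) :=
    inf_compl_sup (A := Aᵒᵈ) _ _
  calc x ⊓ ((x ⊓ y) ⊓ z)
      = (xᶜ ⊔ ((x ⊓ y) ⊓ z)) ⊓ (x ⊔ ((x ⊓ y) ⊔ ((x ⊓ y) ⊓ z))) := by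
        rw [sup_inf_self, sup_inf_self, compl_sup_inf_self, inf_inf_cancel]
    _ = (xᶜ ⊓ (x ⊓ y)) ⊔ ((x ⊓ y) ⊓ z) := by rw [sup_inf_right xᶜ, compl_compl]
    _ = ((x ⊓ xᶜ) ⊓ z) ⊔ ((x ⊓ xᶜ)ᶜ ⊓ ((x ⊓ y) ⊓ z)) := by
      rw [compl_inf_inf, inf_compl_self_inf, h_sup]
    _ = (x ⊓ y) ⊓ z := by rw [← inf_sup_right, inf_compl_sup_inf_left]

theorem inf_assoc (x y z : A) : (x ⊓ y) ⊓ z = x ⊓ (y ⊓ z) := by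
  have h : xᶜ ⊔ (x ⊓ y) = xᶜ ⊔ y := by
    have h : xᶜ ⊔ (xᶜᶜ ⊓ y) = xᶜ ⊔ y := inf_compl_sup (A := Aᵒᵈ) xᶜ y
    rwa [compl_compl] at h
  rw [← inf_inf_inf_self_left, ← inf_compl_sup_inf_right, h, inf_compl_sup_inf_right]

end CAlgebra

namespace DistribCAlgebra

variable {A : Type*} [DistribCAlgebra A]

theorem sup_inf_left (x y z : A) : x ⊔ (y ⊓ z) = (x ⊔ y) ⊓ (x ⊔ z) :=
  compl_injective (by rw [compl_sup, compl_inf, inf_sup_left, compl_inf, compl_sup, compl_sup])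

theorem sup_inf_right (x y z : A) : (x ⊓ y) ⊔ z = (x ⊔ z) ⊓ ((xᶜ ⊔ y) ⊔ z) :=
  compl_injective (by
    rw [compl_sup, compl_inf, inf_sup_right, compl_inf, compl_sup, compl_sup, compl_sup])

instance : DistribCAlgebra Aᵒᵈ where
  inf_sup_left := sup_inf_left (A := A)
  inf_sup_right := sup_inf_right (A := A)

theorem sup_compl_inf_inf_self (x : A) : ((x ⊔ xᶜ) ⊓ x) ⊓ x = x :=
  calc ((x ⊔ xᶜ) ⊓ x) ⊓ x
      = (x ⊔ (xᶜ ⊓ x)) ⊓ (x ⊔ x) := by rw [sup_inf_left, sup_idem]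
    _ = (x ⊓ x) ⊔ ((xᶜ ⊓ x) ⊓ x) := by rw [← sup_inf_left, inf_idem]
    _ = x := by rw [← inf_sup_right, sup_idem, inf_idem]

theorem inf_compl_inf_self (x : A) : (x ⊓ xᶜ) ⊓ x = x ⊓ xᶜ := by
  have h : ((x ⊓ xᶜ) ⊔ x) ⊔ x = x := sup_compl_inf_inf_self (A := Aᵒᵈ) x
  calc (x ⊓ xᶜ) ⊓ x
      = (x ⊓ xᶜ) ⊓ (((x ⊓ xᶜ) ⊔ x) ⊔ x) := by rw [h]
    _ = x ⊓ xᶜ := by rw [inf_sup_left, inf_sup_self, sup_inf_self]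

theorem inf_compl_comm (x : A) : x ⊓ xᶜ = xᶜ ⊓ x := by
  have h (x : A) : (x ⊓ xᶜ) ⊔ (xᶜ ⊓ x) = x ⊓ xᶜ :=
    calc (x ⊓ xᶜ) ⊔ (xᶜ ⊓ x)
        = (x ⊓ xᶜ) ⊔ ((xᶜ ⊓ x) ⊓ xᶜ) := by
          have h := inf_compl_inf_self xᶜ
          rw [compl_compl] at h
          rw [h]
      _ = x ⊓ xᶜ := by rw [← inf_sup_right, sup_idem]
  exact inf_compl_comm_of_sup_eq h x

theorem sup_compl_sup_inf (x y z : A) : (x ⊔ (xᶜ ⊔ y)) ⊓ z = (x ⊔ xᶜ) ⊓ z := by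
  rw [inf_sup_right, inf_sup_right, inf_sup_self, inf_idem]

theorem inf_compl_inf (x y : A) : x ⊓ (xᶜ ⊓ y) = x ⊓ xᶜ := by
  have h (z : A) : (x ⊓ (xᶜ ⊓ y)) ⊔ z = (x ⊓ xᶜ) ⊔ z := sup_compl_sup_inf (A := Aᵒᵈ) x y z
  calc x ⊓ (xᶜ ⊓ y)
      = (x ⊓ xᶜ) ⊔ (x ⊓ (xᶜ ⊓ y)) := by rw [← h, sup_idem]
    _ = x ⊓ xᶜ := by rw [← inf_sup_left, sup_inf_self]

theorem inf_sup_eq_left {w a : A} (h : w ⊓ a = w) (b : A) : w ⊓ (a ⊔ b) = w := by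
  rw [inf_sup_left, h, sup_inf_self]

theorem inf_compl_self_inf (x y : A) : (x ⊓ xᶜ) ⊓ y = x ⊓ xᶜ := by
  set w := x ⊓ xᶜ with hw
  have h_compl : w ⊓ xᶜ = w := by
    simpa only [hw, compl_compl, ← inf_compl_comm] using inf_compl_inf_self xᶜ
  have h_sup (a b : A) : w ⊓ (a ⊔ b) = w :=
    calc w ⊓ (a ⊔ b)
        = (w ⊔ (w ⊓ b)) ⊓ ((wᶜ ⊔ a) ⊔ (w ⊓ b)) := by rw [inf_sup_left, sup_inf_right]
      _ = w ⊓ (((xᶜ ⊔ xᶜᶜ) ⊔ a) ⊔ (w ⊓ b)) := by rw [sup_inf_self, hw, compl_inf]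
      _ = w := inf_sup_eq_left (inf_sup_eq_left (inf_sup_eq_left h_compl _) _) _
  rw [← sup_idem y, h_sup]

theorem compl_inf_self_inf (x y : A) : (xᶜ ⊓ x) ⊓ y = xᶜ ⊓ x := by
  rw [← inf_compl_comm, inf_compl_self_inf]

theorem inf_sup_compl (x y : A) : x ⊓ (y ⊔ xᶜ) = x ⊓ y :=
  calc x ⊓ (y ⊔ xᶜ)
      = (x ⊓ y) ⊔ ((xᶜ ⊓ x) ⊓ y) := by rw [inf_sup_left, compl_inf_self_inf, inf_compl_comm]
    _ = x ⊓ y := by rw [← inf_sup_right, sup_idem]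

theorem sup_compl_inf_self (x : A) : (x ⊔ xᶜ) ⊓ x = x :=
  calc (x ⊔ xᶜ) ⊓ x
      = x ⊔ (xᶜ ⊓ x) := by rw [sup_inf_left, sup_idem]
    _ = x := by rw [← inf_compl_comm, sup_inf_self]

theorem compl_inf_self_sup (x y : A) : (xᶜ ⊓ x) ⊔ (x ⊓ y) = x ⊓ y := by
  have h : (x ⊓ xᶜ) ⊔ x = x := sup_compl_inf_self (A := Aᵒᵈ) x
  calc (xᶜ ⊓ x) ⊔ (x ⊓ y)
      = ((xᶜ ⊓ x) ⊓ y) ⊔ (((xᶜ ⊓ x)ᶜ ⊓ x) ⊓ y) := by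
        rw [compl_inf_self_inf, compl_inf, compl_compl, sup_compl_inf_self]
    _ = x ⊓ y := by rw [← inf_sup_right, ← inf_compl_comm, h]

theorem inf_compl_sup (x y : A) : x ⊓ (xᶜ ⊔ y) = x ⊓ y := by
  rw [inf_sup_left, inf_compl_comm, compl_inf_self_sup]

theorem compl_sup_inf (x y : A) : xᶜ ⊔ (x ⊓ y) = xᶜ ⊔ y := by
  have h : xᶜ ⊔ (xᶜᶜ ⊓ y) = xᶜ ⊔ y := inf_compl_sup (A := Aᵒᵈ) xᶜ y
  rwa [compl_compl] at h

theorem inf_inf_self_left (x y : A) : x ⊓ (x ⊓ y) = x ⊓ y := by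
  rw [← inf_compl_sup, compl_sup_inf, inf_compl_sup]

theorem inf_inf_self (x y : A) : (x ⊓ y) ⊓ x = x ⊓ y := by
  set w := x ⊓ y with hw
  have h : wᶜ ⊔ (x ⊓ w) = wᶜ ⊔ x := by
    have h : wᶜ ⊔ (x ⊓ wᶜᶜ) = wᶜ ⊔ x := inf_sup_compl (A := Aᵒᵈ) wᶜ x
    rwa [compl_compl] at h
  calc w ⊓ x
      = w ⊓ (x ⊓ w) := by rw [← inf_compl_sup, ← h, inf_compl_sup]
    _ = w := by rw [hw, inf_inf_self_left, inf_idem]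

theorem compl_sup_inf_self (x y : A) : (xᶜ ⊔ y) ⊓ x = x ⊓ y := by
  rw [inf_sup_right, compl_compl, inf_inf_self, compl_inf_self_sup]

theorem inf_inf_inf_self_left (x y z : A) : x ⊓ ((x ⊓ y) ⊓ z) = x ⊓ (y ⊓ z) := by
  have h : xᶜ ⊔ ((x ⊓ y) ⊓ z) = xᶜ ⊔ (y ⊓ z) := by
    rw [sup_inf_left, compl_sup_inf, ← sup_inf_left]
  rw [← inf_compl_sup, h, inf_compl_sup]

theorem sup_inf_compl_inf (x y z : A) : (x ⊔ y) ⊓ (xᶜ ⊓ z) = (x ⊓ xᶜ) ⊔ ((xᶜ ⊓ y) ⊓ z) := by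
  set w := xᶜ ⊓ y with hw
  have h : w ⊓ (xᶜ ⊓ z) = w ⊓ z := by
    rw [← inf_inf_inf_self_left w xᶜ z, hw, inf_inf_self, inf_inf_self_left]
  rw [inf_sup_right, inf_compl_inf, ← hw, h]

theorem inf_compl_self_sup_inf (x y z : A) :
    ((x ⊓ xᶜ) ⊔ y) ⊓ z = (x ⊓ xᶜ) ⊔ (y ⊓ z) := by
  set w := x ⊓ xᶜ with hw
  have h : w ⊔ ((wᶜ ⊓ y) ⊓ z) = w ⊔ (y ⊓ z) := by
    have h : w ⊔ (wᶜ ⊓ y) = w ⊔ y := inf_compl_sup (A := Aᵒᵈ) w y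
    rw [sup_inf_left, h, ← sup_inf_left]
  rw [inf_sup_right, hw, inf_compl_self_inf, ← hw, h]

theorem compl_sup_inf_inf (x y z : A) : (xᶜ ⊔ y) ⊓ (x ⊓ z) = (x ⊓ y) ⊓ z := by
  have h := sup_inf_compl_inf xᶜ y z
  rw [compl_compl] at h
  rw [h, ← inf_compl_comm, ← inf_compl_self_sup_inf, inf_compl_comm, compl_inf_self_sup]

theorem inf_assoc (x y z : A) : (x ⊓ y) ⊓ z = x ⊓ (y ⊓ z) := by
  have h : (x ⊓ yᶜ) ⊔ (xᶜ ⊔ z) = (xᶜ ⊔ yᶜ) ⊔ z := by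
    have h : (xᶜᶜ ⊓ yᶜ) ⊔ (xᶜ ⊔ z) = (xᶜ ⊔ yᶜ) ⊔ z := compl_sup_inf_inf (A := Aᵒᵈ) xᶜ yᶜ z
    rwa [compl_compl] at h
  calc (x ⊓ y) ⊓ z
      = ((xᶜ ⊔ yᶜ) ⊔ z) ⊓ (x ⊓ y) := by rw [← compl_sup_inf_self, compl_inf]
    _ = ((x ⊓ yᶜ) ⊔ (xᶜ ⊔ z)) ⊓ ((xᶜ ⊔ y) ⊓ x) := by rw [h, compl_sup_inf_self]
    _ = ((xᶜ ⊔ y)ᶜ ⊔ (xᶜ ⊔ z)) ⊓ ((xᶜ ⊔ y) ⊓ x) := by rw [compl_sup, compl_compl]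
    _ = ((xᶜ ⊔ y) ⊓ (xᶜ ⊔ z)) ⊓ x := compl_sup_inf_inf (xᶜ ⊔ y) (xᶜ ⊔ z) x
    _ = x ⊓ (y ⊓ z) := by rw [← sup_inf_left, compl_sup_inf_self]

instance : CAlgebra A where
  inf_sup_right x y z := by rw [inf_sup_right, inf_assoc]

end DistribCAlgebra

namespace CAlgebra

variable {A : Type*} [CAlgebra A]

theorem compl_sup_inf (x y : A) : xᶜ ⊔ (x ⊓ y) = xᶜ ⊔ y := by
  have h : xᶜ ⊔ (xᶜᶜ ⊓ y) = xᶜ ⊔ y := inf_compl_sup (A := Aᵒᵈ) xᶜ y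
  rwa [compl_compl] at h

theorem compl_inf_sup (x y : A) : xᶜ ⊓ (x ⊔ y) = xᶜ ⊓ y := compl_sup_inf (A := Aᵒᵈ) x y

theorem inf_compl_inf_self (x y : A) : x ⊓ (x ⊓ y)ᶜ = x ⊓ yᶜ := by
  rw [compl_inf, inf_compl_sup]

theorem inf_inf_inf_cancel (x y z : A) : x ⊓ (y ⊓ (x ⊓ z)) = x ⊓ (y ⊓ z) := by
  rw [← inf_assoc y, ← inf_assoc x, inf_inf_cancel, inf_assoc]

theorem sup_sup_sup_cancel (x y z : A) : x ⊔ (y ⊔ (x ⊔ z)) = x ⊔ (y ⊔ z) :=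
  inf_inf_inf_cancel (A := Aᵒᵈ) x y z

theorem inf_sup_left (x y z : A) : x ⊓ (y ⊔ z) = (x ⊓ y) ⊔ (x ⊓ z) := by
  rw [sup_inf_right, sup_inf_self, ← sup_sup_sup_cancel, compl_sup_inf, sup_sup_sup_cancel,
    inf_compl_sup]

/-- The conditional that is `b` if `a` is true and `c` if `a` is false. -/
def branch (a b c : A) : A := (a ⊓ b) ⊔ (aᶜ ⊓ c)

/-- The test whether `a` is defined: in `C`, its value is `T` if `a ≠ U`, and `U` if `a = U`. -/
def dom (a : A) : A := a ⊔ aᶜ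

theorem dom_compl (a : A) : dom aᶜ = dom a := by
  rw [dom, dom, compl_compl, sup_compl_comm]

theorem dom_inf (a y : A) : dom a ⊓ y = (a ⊓ y) ⊔ (aᶜ ⊓ y) := by
  rw [dom, inf_sup_right, inf_inf_self_left]

theorem dom_sup (a y : A) : dom a ⊔ y = dom a := sup_compl_self_sup a y

theorem inf_dom (a : A) : a ⊓ dom a = a := inf_sup_self a aᶜ

theorem dom_inf_sup (a y : A) : dom a ⊓ (a ⊔ y) = a ⊔ y :=
  inf_compl_sup_inf_left (A := Aᵒᵈ) a y

theorem dom_inf_comm (a b : A) : dom a ⊓ dom b = dom b ⊓ dom a := by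
  have h (a b z : A) : (dom a ⊓ dom b) ⊔ z = dom a ⊓ dom b := by
    rw [sup_inf_right, dom_sup, dom_sup, inf_compl_sup]
  simpa only [h] using inf_sup_inf_comm (dom a) (dom b)

theorem inf_branch (a b c : A) : a ⊓ branch a b c = a ⊓ b := by
  rw [branch, inf_sup_left, inf_inf_self_left, inf_compl_inf, inf_sup_inf_compl]

theorem compl_inf_branch (a b c : A) : aᶜ ⊓ branch a b c = aᶜ ⊓ c := by
  rw [branch, inf_sup_left, compl_inf_inf, inf_inf_self_left, inf_compl_comm, ← inf_sup_left,
    compl_inf_sup]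

theorem eq_branch {a b c y : A} (h : dom a ⊓ y = y) (hb : a ⊓ y = a ⊓ b) (hc : aᶜ ⊓ y = aᶜ ⊓ c) :
    y = branch a b c := by
  rw [← h, dom_inf, hb, hc, branch]

theorem dom_inf_branch (a b c : A) : dom a ⊓ branch a b c = branch a b c := by
  rw [dom_inf, inf_branch, compl_inf_branch, branch]

theorem compl_branch (a b c : A) : (branch a b c)ᶜ = branch a bᶜ cᶜ := by
  refine eq_branch ?_ ?_ ?_
  · rw [branch, compl_sup, compl_inf a b, ← inf_assoc, ← dom_compl, dom_inf_sup]
  · rw [← inf_compl_inf_self, inf_branch, inf_compl_inf_self]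
  · rw [← inf_compl_inf_self, compl_inf_branch, inf_compl_inf_self]

theorem branch_inf (a b c d : A) : branch a b c ⊓ d = branch a (b ⊓ d) (c ⊓ d) := by
  refine eq_branch ?_ ?_ ?_
  · rw [← inf_assoc, dom_inf_branch]
  · rw [← inf_assoc, inf_branch, inf_assoc]
  · rw [← inf_assoc, compl_inf_branch, inf_assoc]

theorem inf_branch_congr {x a a' b b' c c' : A} (ha : x ⊓ a = x ⊓ a') (hb : x ⊓ b = x ⊓ b')
    (hc : x ⊓ c = x ⊓ c') : x ⊓ branch a b c = x ⊓ branch a' b' c' := by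
  have h (a b c : A) :
      x ⊓ branch a b c = ((x ⊓ a) ⊓ (x ⊓ b)) ⊔ ((x ⊓ (x ⊓ a)ᶜ) ⊓ (x ⊓ c)) := by
    rw [branch, inf_sup_left, inf_compl_inf_self, inf_assoc, inf_assoc, inf_inf_inf_cancel,
      inf_inf_inf_cancel]
  rw [h, h a', ha, hb, hc]

theorem dom_inf_branch_of_dom_inf {a b m n : A} (hm : dom a ⊓ m = m) (hn : dom a ⊓ n = n) :
    dom a ⊓ branch b m n = branch b m n := by
  refine eq_branch ?_ ?_ ?_
  · rw [← inf_assoc, dom_inf_comm, inf_assoc, dom_inf_branch]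
  · rw [← inf_inf_inf_cancel, inf_branch, inf_inf_inf_cancel, hm]
  · rw [← inf_inf_inf_cancel, compl_inf_branch, inf_inf_inf_cancel, hn]

theorem inf_of_compl_eq {u : A} (hu : uᶜ = u) (x : A) : u ⊓ x = u := by
  simpa only [hu, inf_idem] using inf_compl_self_inf u x

theorem dom_inf_of_compl_eq {u : A} (hu : uᶜ = u) (a : A) : dom a ⊓ u = u := by
  have h : dom u = u := by rw [dom, hu, sup_idem]
  rw [← h, dom_inf_comm, h, inf_of_compl_eq hu]

end CAlgebra

/-- A C-algebra with a distinguished element `⊤` that plays the role of `T`; that of `F` is played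
by `⊤ᶜ`. -/
class BoundedCAlgebra (A : Type*) extends CAlgebra A, Top A where
  top_inf (x : A) : ⊤ ⊓ x = x

namespace BoundedCAlgebra

open CAlgebra

variable {A : Type*} [BoundedCAlgebra A]

theorem compl_top_sup (x : A) : ⊤ᶜ ⊔ x = x :=
  compl_injective (by rw [compl_sup, compl_compl, top_inf])

theorem compl_top_inf (x : A) : ⊤ᶜ ⊓ x = ⊤ᶜ := by
  rw [← compl_top_sup x, inf_sup_self]

theorem inf_top (x : A) : x ⊓ ⊤ = x := by
  have h : dom (⊤ : A) = ⊤ := by rw [← top_inf (dom ⊤), inf_dom]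
  calc x ⊓ ⊤ = x ⊓ (dom x ⊓ dom ⊤) := by rw [← CAlgebra.inf_assoc, inf_dom, h]
    _ = x := by rw [dom_inf_comm, h, top_inf, inf_dom]

theorem sup_compl_top (x : A) : x ⊔ ⊤ᶜ = x :=
  compl_injective (by rw [compl_sup, compl_compl, inf_top])

theorem inf_compl_top (x : A) : x ⊓ ⊤ᶜ = x ⊓ xᶜ := by
  rw [← inf_compl_inf_self, inf_top]

theorem branch_top (x y : A) : branch ⊤ x y = x := by
  rw [branch, top_inf, compl_top_inf, sup_compl_top]

theorem branch_compl_top (x y : A) : branch ⊤ᶜ x y = y := by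
  rw [branch, compl_compl, top_inf, compl_top_inf, compl_top_sup]

theorem branch_top_compl_top (x : A) : branch x ⊤ ⊤ᶜ = x := by
  rw [branch, inf_top, inf_compl_top, compl_compl, ← inf_compl_comm, sup_inf_self]

end BoundedCAlgebra

/-- The C-algebra obtained from `A` by adjoining fresh elements for truth and falsity. -/
inductive WithBounds (A : Type*) : Type _
  | top : WithBounds A
  | bot : WithBounds A
  | of (a : A) : WithBounds A

namespace WithBounds

open CAlgebra

variable {A : Type*} [CAlgebra A]

instance : Compl (WithBounds A) where
  compl
    | top => bot
    | bot => top
    | of a => of aᶜ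

instance : Min (WithBounds A) where
  min
    | top, y => y
    | bot, _ => bot
    | of a, top => of a
    | of a, bot => of (a ⊓ aᶜ)
    | of a, of b => of (a ⊓ b)

instance : Max (WithBounds A) where
  max
    | top, _ => top
    | bot, y => y
    | of a, top => of (a ⊔ aᶜ)
    | of a, bot => of a
    | of a, of b => of (a ⊔ b)

theorem compl_top : (top : WithBounds A)ᶜ = bot := rfl
theorem compl_bot : (bot : WithBounds A)ᶜ = top := rfl
theorem compl_of (a : A) : (of a)ᶜ = of aᶜ := rfl
theorem top_inf (y : WithBounds A) : top ⊓ y = y := rfl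
theorem bot_inf (y : WithBounds A) : bot ⊓ y = bot := rfl
theorem of_inf_top (a : A) : of a ⊓ top = of a := rfl
theorem of_inf_bot (a : A) : of a ⊓ bot = of (a ⊓ aᶜ) := rfl
theorem of_inf_of (a b : A) : of a ⊓ of b = of (a ⊓ b) := rfl
theorem top_sup (y : WithBounds A) : top ⊔ y = top := rfl
theorem bot_sup (y : WithBounds A) : bot ⊔ y = y := rfl
theorem of_sup_top (a : A) : of a ⊔ top = of (a ⊔ aᶜ) := rfl
theorem of_sup_bot (a : A) : of a ⊔ bot = of a := rfl
theorem of_sup_of (a b : A) : of a ⊔ of b = of (a ⊔ b) := rfl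

instance : BoundedCAlgebra (WithBounds A) where
  top := top
  top_inf _ := rfl
  compl_compl x := by
    cases x <;> simp only [compl_top, compl_bot, compl_of, compl_compl]
  compl_inf x y := by
    rcases x with _ | _ | a <;> rcases y with _ | _ | b <;>
      simp only [compl_top, compl_bot, compl_of, top_inf, bot_inf, of_inf_top, of_inf_bot,
        of_inf_of, top_sup, bot_sup, of_sup_top, of_sup_bot, of_sup_of, compl_inf]
  sup_inf_self x y := by
    rcases x with _ | _ | a <;> rcases y with _ | _ | b <;>
      simp only [top_inf, bot_inf, of_inf_top, of_inf_bot, of_inf_of, top_sup, bot_sup, of_sup_of,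
        sup_inf_self, sup_idem]
  inf_sup_inf_comm x y := by
    rcases x with _ | _ | a <;> rcases y with _ | _ | b <;>
      simp only [top_inf, bot_inf, of_inf_top, of_inf_bot, of_inf_of, top_sup, bot_sup, of_sup_bot,
        of_sup_of, inf_sup_inf_comm]
  inf_sup_right x y z := by
    rcases x with _ | _ | a <;> rcases y with _ | _ | b <;> rcases z with _ | _ | c <;>
      simp only [compl_top, compl_bot, compl_of, top_inf, bot_inf, of_inf_top, of_inf_bot,
        of_inf_of, top_sup, bot_sup, of_sup_top, of_sup_bot, of_sup_of, CAlgebra.inf_sup_right]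
    case of.top.bot => rw [compl_sup, inf_compl_inf, inf_inf_self_left, inf_inf_self_left]
    case of.top.of => rw [inf_inf_self_left]
    case of.bot.top => rw [compl_compl, ← inf_compl_comm, sup_inf_self]
    case of.bot.bot | of.bot.of => rw [compl_compl, ← inf_compl_comm, inf_sup_inf_compl]
    case of.of.top =>
      have h : a ⊔ (aᶜ ⊓ b) = a ⊔ b := inf_compl_sup (A := Aᵒᵈ) a b
      rw [h]
    case of.of.bot => rw [compl_sup, inf_compl_inf, inf_inf_inf_cancel]

end WithBounds

namespace C

instance : DecidableEq C := by
  rintro (_ | _ | _) (_ | _ | _) <;> first | exact isTrue rfl | exact isFalse nofun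

instance : Fintype C := ⟨{T, F, U}, by rintro (_ | _ | _) <;> decide⟩

instance : BoundedCAlgebra C where
  compl := neg
  min := and
  max := or
  top := T
  compl_compl := by decide
  compl_inf := by decide
  sup_inf_self := by decide
  inf_sup_inf_comm := by decide
  inf_sup_right := by decide
  top_inf _ := rfl

end C

/-- Decision trees; the leaf for the undefined truth value is available only if `P` holds. -/
inductive Tree (P : Prop) : Type
  | tt : Tree P
  | ff : Tree P
  | uu (h : P) : Tree P
  | node (n : ℕ) (l r : Tree P) : Tree P

namespace Tree

open CAlgebra BoundedCAlgebra

variable {P : Prop} {A : Type*} [BoundedCAlgebra A]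

/-- The value of a tree in a bounded C-algebra, where `u` denotes undefinedness. -/
def ev (u : A) (v : ℕ → A) : Tree P → A
  | tt => ⊤
  | ff => ⊤ᶜ
  | uu _ => u
  | node n l r => branch (v n) (l.ev u v) (r.ev u v)

/-- Negation of trees. -/
def neg : Tree P → Tree P
  | tt => ff
  | ff => tt
  | uu h => uu h
  | node n l r => node n l.neg r.neg

/-- Conjunction of trees: `q` is grafted onto the leaves `tt`. -/
def and : Tree P → Tree P → Tree P
  | tt, q => q
  | ff, _ => ff
  | uu h, _ => uu h
  | node n l r, q => node n (l.and q) (r.and q)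

/-- The number of inner nodes, on which the inductions on trees run. -/
def size : Tree P → ℕ
  | node _ l r => l.size + r.size + 1
  | _ => 0

/-- The tree that remains of a tree once the variable `n` is known to have the truth value `b`. -/
def restrict (n : ℕ) (b : Bool) : Tree P → Tree P
  | node m l r =>
    if m = n then bif b then l.restrict n b else r.restrict n b
    else node m (l.restrict n b) (r.restrict n b)
  | p => p

theorem ev_neg {u : A} (hu : P → uᶜ = u) (v : ℕ → A) (p : Tree P) :
    p.neg.ev u v = (p.ev u v)ᶜ := by
  induction p with
  | tt => rfl
  | ff => exact (compl_compl ⊤).symm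
  | uu h => exact (hu h).symm
  | node n l r ihl ihr => rw [neg, ev, ev, ihl, ihr, compl_branch]

theorem ev_and {u : A} (hu : P → uᶜ = u) (v : ℕ → A) (p q : Tree P) :
    (p.and q).ev u v = p.ev u v ⊓ q.ev u v := by
  induction p with
  | tt => exact (top_inf _).symm
  | ff => exact (compl_top_inf _).symm
  | uu h => exact (inf_of_compl_eq (hu h) _).symm
  | node n l r ihl ihr => rw [and, ev, ev, ihl, ihr, branch_inf]

theorem inf_ev_congr (u : A) {v w : ℕ → A} {x : A} (h : ∀ n, x ⊓ v n = x ⊓ w n) (p : Tree P) :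
    x ⊓ p.ev u v = x ⊓ p.ev u w := by
  induction p with
  | node n l r ihl ihr => exact inf_branch_congr (h n) ihl ihr
  | _ => rfl

theorem size_restrict_le (n : ℕ) (b : Bool) (p : Tree P) : (p.restrict n b).size ≤ p.size := by
  induction p with
  | node m l r ihl ihr =>
    rw [restrict]
    split_ifs
    · cases b <;> simp only [cond_true, cond_false, size] <;> omega
    · simp only [size]
      omega
  | _ => exact le_rfl

theorem size_restrict_node_lt (n : ℕ) (b : Bool) (l r : Tree P) :
    ((node n l r).restrict n b).size < (node n l r).size := by
  have hl := size_restrict_le n b l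
  have hr := size_restrict_le n b r
  cases b <;> simp only [restrict, if_true, cond_true, cond_false, size] <;> omega

theorem ev_restrict (u : A) (v : ℕ → A) (n : ℕ) (b : Bool) (p : Tree P) :
    (p.restrict n b).ev u v = p.ev u (Function.update v n (bif b then ⊤ else ⊤ᶜ)) := by
  induction p with
  | node m l r ihl ihr =>
    rw [restrict]
    split_ifs with h
    · subst h
      cases b
      · rw [ev, Function.update_self, cond_false, cond_false, branch_compl_top, ihr, cond_false]
      · rw [ev, Function.update_self, cond_true, cond_true, branch_top, ihl, cond_true]
    · rw [ev, ev, ihl, ihr, Function.update_of_ne h]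
  | _ => rfl

theorem ev_eq_branch_restrict {u : A} {v : ℕ → A} {n : ℕ} {p : Tree P}
    (h : dom (v n) ⊓ p.ev u v = p.ev u v) :
    p.ev u v = branch (v n) ((p.restrict n true).ev u v) ((p.restrict n false).ev u v) := by
  refine eq_branch h ?_ ?_ <;> rw [ev_restrict] <;> refine inf_ev_congr u (fun m => ?_) p <;>
    obtain rfl | hm := eq_or_ne m n
  · rw [Function.update_self, cond_true, inf_top, inf_idem]
  · rw [Function.update_of_ne hm]
  · rw [Function.update_self, cond_false, inf_compl_top, compl_compl]
  · rw [Function.update_of_ne hm]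

theorem ev_node_eq_U {n : ℕ} {w : ℕ → C} (hw : w n = C.U) (l r : Tree P) :
    (node n l r).ev C.U w = C.U := by
  rw [ev, hw]
  rfl

theorem dom_inf_ev {u : A} (hu : P → uᶜ = u) (v : ℕ → A) (n : ℕ) : ∀ p : Tree P,
    (∀ w : ℕ → C, w n = C.U → p.ev C.U w = C.U) → dom (v n) ⊓ p.ev u v = p.ev u v
  | tt, hp => nomatch hp (fun _ => C.U) rfl
  | ff, hp => nomatch hp (fun _ => C.U) rfl
  | uu h, _ => dom_inf_of_compl_eq (hu h) _
  | node m l r, hp => by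
    obtain rfl | hm := eq_or_ne n m
    · exact dom_inf_branch _ _ _
    have ih (b : Bool) := dom_inf_ev hu v n ((node m l r).restrict m b) fun w hw => by
      rw [ev_restrict, hp]
      rw [Function.update_of_ne hm, hw]
    rw [ev_eq_branch_restrict (n := m) (dom_inf_branch _ _ _)]
    exact dom_inf_branch_of_dom_inf (ih true) (ih false)
termination_by p => p.size
decreasing_by exact size_restrict_node_lt m b l r

theorem ev_eq_of_ev_restrict_eq {u : A} (hu : P → uᶜ = u) (v : ℕ → A) {n : ℕ} {p q : Tree P}
    (hp : ∀ w : ℕ → C, w n = C.U → p.ev C.U w = C.U)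
    (hq : ∀ w : ℕ → C, w n = C.U → q.ev C.U w = C.U)
    (h : ∀ b, (p.restrict n b).ev u v = (q.restrict n b).ev u v) : p.ev u v = q.ev u v := by
  rw [ev_eq_branch_restrict (dom_inf_ev hu v n p hp),
    ev_eq_branch_restrict (dom_inf_ev hu v n q hq), h, h]

theorem ev_eq_of_forall_ev_eq {u : A} (hu : P → uᶜ = u) (v : ℕ → A) : ∀ p q : Tree P,
    (∀ w : ℕ → C, p.ev C.U w = q.ev C.U w) → p.ev u v = q.ev u v
  | tt, tt, _ => rfl
  | ff, ff, _ => rfl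
  | uu _, uu _, _ => rfl
  | tt, ff, h | tt, uu _, h | ff, tt, h | ff, uu _, h | uu _, tt, h | uu _, ff, h =>
    nomatch h fun _ => C.U
  | node n l r, q, h =>
    ev_eq_of_ev_restrict_eq hu v (fun _ hw => ev_node_eq_U hw l r)
      (fun w hw => (h w).symm.trans (ev_node_eq_U hw l r))
      fun b => ev_eq_of_forall_ev_eq hu v _ _ fun w => by rw [ev_restrict, ev_restrict, h]
  | p, node n l r, h =>
    ev_eq_of_ev_restrict_eq hu v (fun w hw => (h w).trans (ev_node_eq_U hw l r))
      (fun _ hw => ev_node_eq_U hw l r)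
      fun b => ev_eq_of_forall_ev_eq hu v _ _ fun w => by rw [ev_restrict, ev_restrict, h]
termination_by p q => p.size + q.size
decreasing_by
  · exact add_lt_add_of_lt_of_le (size_restrict_node_lt n b l r) (size_restrict_le n b q)
  all_goals exact add_lt_add_of_le_of_lt (size_restrict_le n b _) (size_restrict_node_lt n b l r)

end Tree

/-- An interpretation on `A` of the operations and of the three constants, without any laws. -/
structure Model (A : Type*) where
  neg : A → A
  and : A → A → A
  or : A → A → A
  const : C → A

namespace Model

variable {K : Set C} {A : Type*}

/-- The value of a term in a model under a valuation of the variables. -/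
def eval (M : Model A) (v : ℕ → A) : Term K → A
  | .var n => v n
  | .const c _ => M.const c
  | .neg s => M.neg (M.eval v s)
  | .and s t => M.and (M.eval v s) (M.eval v t)
  | .or s t => M.or (M.eval v s) (M.eval v t)

/-- Validity of an equation in a model. -/
def Satisfies (M : Model A) (e : Equation K) : Prop :=
  ∀ v, M.eval v e.lhs = M.eval v e.rhs

theorem eval_subst (M : Model A) (v : ℕ → A) (σ : ℕ → Term K) (s : Term K) :
    M.eval v (s.subst σ) = M.eval (fun n => M.eval v (σ n)) s := by
  induction s with
  | var n => rfl
  | const c hc => rfl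
  | neg s ih => rw [Term.subst, eval, ih, eval]
  | and s t ihs iht | or s t ihs iht => rw [Term.subst, eval, ihs, iht, eval]

theorem satisfies_of_derives {M : Model A} {Γ : Set (Equation K)} (hM : ∀ e ∈ Γ, M.Satisfies e)
    {s t : Term K} (h : Derives Γ s t) : M.Satisfies ⟨s, t⟩ := by
  intro v
  induction h with
  | ax e he σ => simpa only [eval_subst] using hM e he _
  | refl s => rfl
  | symm _ ih => exact ih.symm
  | trans _ _ ih₁ ih₂ => exact ih₁.trans ih₂
  | neg _ ih => exact congrArg M.neg ih
  | and _ _ ih₁ ih₂ => exact congrArg₂ M.and ih₁ ih₂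
  | or _ _ ih₁ ih₂ => exact congrArg₂ M.or ih₁ ih₂

/-- The valuation of `x`, `y` and `z` by three given elements. -/
def valuation (a b c : A) : ℕ → A
  | 0 => a
  | 1 => b
  | _ => c

variable {M : Model A}

theorem satisfies_ax1a : M.Satisfies (ax1a : Equation K) ↔ ∀ a, M.neg (M.neg a) = a :=
  ⟨fun h a => h (valuation a a a), fun h v => h (v 0)⟩

theorem satisfies_ax1b :
    M.Satisfies (ax1b : Equation K) ↔ ∀ a b, M.neg (M.and a b) = M.or (M.neg a) (M.neg b) :=
  ⟨fun h a b => h (valuation a b a), fun h v => h (v 0) (v 1)⟩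

theorem satisfies_ax1c :
    M.Satisfies (ax1c : Equation K) ↔ ∀ a b c, M.and (M.and a b) c = M.and a (M.and b c) :=
  ⟨fun h a b c => h (valuation a b c), fun h v => h (v 0) (v 1) (v 2)⟩

theorem satisfies_ax1d :
    M.Satisfies (ax1d : Equation K) ↔
      ∀ a b c, M.and a (M.or b c) = M.or (M.and a b) (M.and a c) :=
  ⟨fun h a b c => h (valuation a b c), fun h v => h (v 0) (v 1) (v 2)⟩

theorem satisfies_mem1 :
    M.Satisfies (mem1 : Equation K) ↔
      ∀ a b c, M.and (M.or a b) c = M.or (M.and a c) (M.and (M.neg a) (M.and b c)) :=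
  ⟨fun h a b c => h (valuation a b c), fun h v => h (v 0) (v 1) (v 2)⟩

theorem satisfies_mem2 :
    M.Satisfies (mem2 : Equation K) ↔
      ∀ a b c, M.and (M.or a b) c = M.or (M.and a c) (M.and (M.and (M.neg a) b) c) :=
  ⟨fun h a b c => h (valuation a b c), fun h v => h (v 0) (v 1) (v 2)⟩

theorem satisfies_ax1f : M.Satisfies (ax1f : Equation K) ↔ ∀ a b, M.or a (M.and a b) = a :=
  ⟨fun h a b => h (valuation a b a), fun h v => h (v 0) (v 1)⟩

theorem satisfies_ax1g :
    M.Satisfies (ax1g : Equation K) ↔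
      ∀ a b, M.or (M.and a b) (M.and b a) = M.or (M.and b a) (M.and a b) :=
  ⟨fun h a b => h (valuation a b a), fun h v => h (v 0) (v 1)⟩

theorem satisfies_ax4a {hU : C.U ∈ K} :
    M.Satisfies (ax4a hU) ↔ M.neg (M.const C.U) = M.const C.U :=
  ⟨fun h => h fun _ => M.const C.U, fun h _ => h⟩

theorem satisfies_ax4b {hT : C.T ∈ K} :
    M.Satisfies (ax4b hT) ↔ ∀ a, M.and (M.const C.T) a = a :=
  ⟨fun h a => h (valuation a a a), fun h v => h (v 0)⟩

theorem satisfies_ax4c {hT : C.T ∈ K} {hF : C.F ∈ K} :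
    M.Satisfies (ax4c hT hF) ↔ M.neg (M.const C.T) = M.const C.F :=
  ⟨fun h => h fun _ => M.const C.T, fun h _ => h⟩

/-- The C-algebra underlying a model of the five axioms. -/
abbrev cAlgebra (M : Model A) (h : ∀ e ∈ fiveAxioms K, M.Satisfies e) : CAlgebra A where
  compl := M.neg
  min := M.and
  max := M.or
  compl_compl := satisfies_ax1a.1 (h ax1a (by simp [fiveAxioms]))
  compl_inf := satisfies_ax1b.1 (h ax1b (by simp [fiveAxioms]))
  sup_inf_self := satisfies_ax1f.1 (h ax1f (by simp [fiveAxioms]))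
  inf_sup_inf_comm := satisfies_ax1g.1 (h ax1g (by simp [fiveAxioms]))
  inf_sup_right := satisfies_mem1.1 (h mem1 (by simp [fiveAxioms]))

/-- The C-algebra underlying a model of the six axioms. -/
abbrev distribCAlgebra (M : Model A) (h : ∀ e ∈ sixAxioms K, M.Satisfies e) :
    DistribCAlgebra A where
  compl := M.neg
  min := M.and
  max := M.or
  compl_compl := satisfies_ax1a.1 (h ax1a (by simp [sixAxioms]))
  compl_inf := satisfies_ax1b.1 (h ax1b (by simp [sixAxioms]))
  sup_inf_self := satisfies_ax1f.1 (h ax1f (by simp [sixAxioms]))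
  inf_sup_inf_comm := satisfies_ax1g.1 (h ax1g (by simp [sixAxioms]))
  inf_sup_left := satisfies_ax1d.1 (h ax1d (by simp [sixAxioms]))
  inf_sup_right := satisfies_mem2.1 (h mem2 (by simp [sixAxioms]))

/-- The model on a C-algebra in which the constants are interpreted by `c`. -/
def ofCAlgebra [CAlgebra A] (c : C → A) : Model A where
  neg := compl
  and := min
  or := max
  const := c

/-- The algebra `C` as a model. -/
abbrev standard : Model C := ofCAlgebra id

theorem eval_standard (v : ℕ → C) (s : Term K) : standard.eval v s = s.eval v := by
  induction s with
  | var n => rfl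
  | const c hc => rfl
  | neg s ih => exact congrArg C.neg ih
  | and s t ihs iht => exact congrArg₂ C.and ihs iht
  | or s t ihs iht => exact congrArg₂ C.or ihs iht

theorem standard_satisfies_iff {e : Equation K} :
    standard.Satisfies e ↔ ValidInC e.lhs e.rhs := by
  simp only [ValidInC, Satisfies, eval_standard]

end Model

namespace Term

variable {K : Set C}

/-- The decision tree that evaluates a term. -/
def toTree : Term K → Tree (C.U ∈ K)
  | var n => .node n .tt .ff
  | const .T _ => .tt
  | const .F _ => .ff
  | const .U h => .uu h
  | neg s => s.toTree.neg
  | and s t => s.toTree.and t.toTree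
  | or s t => (s.toTree.neg.and t.toTree.neg).neg

end Term

namespace Model

variable {K : Set C} {A : Type*}

theorem ev_toTree [BoundedCAlgebra A] {c : C → A} (hT : C.T ∈ K → c C.T = ⊤)
    (hF : C.F ∈ K → c C.F = ⊤ᶜ) (hU : C.U ∈ K → (c C.U)ᶜ = c C.U) (v : ℕ → A) (s : Term K) :
    s.toTree.ev (c C.U) v = (ofCAlgebra c).eval v s := by
  induction s with
  | var n => exact BoundedCAlgebra.branch_top_compl_top (v n)
  | const d hd =>
    cases d with
    | T => exact (hT hd).symm
    | F => exact (hF hd).symm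
    | U => rfl
  | neg s ih =>
    rw [Term.toTree, Tree.ev_neg hU, ih]
    rfl
  | and s t ihs iht =>
    rw [Term.toTree, Tree.ev_and hU, ihs, iht]
    rfl
  | or s t ihs iht =>
    rw [Term.toTree, Tree.ev_neg hU, Tree.ev_and hU, Tree.ev_neg hU, Tree.ev_neg hU, compl_inf,
      compl_compl, compl_compl, ihs, iht]
    rfl

theorem eval_eq_of_validInC_of_bounded [BoundedCAlgebra A] {c : C → A}
    (hT : C.T ∈ K → c C.T = ⊤) (hF : C.F ∈ K → c C.F = ⊤ᶜ) (hU : C.U ∈ K → (c C.U)ᶜ = c C.U)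
    {s t : Term K} (h : ValidInC s t) (v : ℕ → A) :
    (ofCAlgebra c).eval v s = (ofCAlgebra c).eval v t := by
  rw [← ev_toTree hT hF hU, ← ev_toTree hT hF hU]
  refine Tree.ev_eq_of_forall_ev_eq hU v _ _ fun w => ?_
  have h_eval (r : Term K) : r.toTree.ev C.U w = r.eval w :=
    (ev_toTree (c := id) (fun _ => rfl) (fun _ => rfl) (fun _ => rfl) w r).trans
      (eval_standard w r)
  rw [h_eval, h_eval, h]

theorem eval_withBounds_of [CAlgebra A] (c : C → A) (v : ℕ → A) (s : Term K) :
    (ofCAlgebra (WithBounds.of ∘ c)).eval (WithBounds.of ∘ v) s =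
      WithBounds.of ((ofCAlgebra c).eval v s) := by
  induction s with
  | var n => rfl
  | const c hc => rfl
  | neg s ih => exact congrArg compl ih
  | and s t ihs iht => exact congrArg₂ min ihs iht
  | or s t ihs iht => exact congrArg₂ max ihs iht

end Model

/-- The axioms for the constants in `K`: (1.4a) if `U` is distinguished, (1.4b) if `T` is, and
(1.4c) if both `T` and `F` are. -/
def constAxioms (K : Set C) : Set (Equation K) :=
  {e | (∃ hU, e = ax4a hU) ∨ (∃ hT, e = ax4b hT) ∨ ∃ hT hF, e = ax4c hT hF}

theorem forall_mem_constAxioms {K : Set C} {p : Equation K → Prop} :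
    (∀ e ∈ constAxioms K, p e) ↔
      (∀ hU, p (ax4a hU)) ∧ (∀ hT, p (ax4b hT)) ∧ ∀ hT hF, p (ax4c hT hF) := by
  constructor
  · exact fun h => ⟨fun hU => h _ (.inl ⟨hU, rfl⟩), fun hT => h _ (.inr (.inl ⟨hT, rfl⟩)),
      fun hT hF => h _ (.inr (.inr ⟨hT, hF, rfl⟩))⟩
  · rintro ⟨hU, hT, hF⟩ e (⟨h, rfl⟩ | ⟨h, rfl⟩ | ⟨h, h', rfl⟩)
    exacts [hU h, hT h, hF h h']

variable {K : Set C}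

theorem Model.eval_eq_of_validInC {A : Type*} [CAlgebra A] {c : C → A}
    (hK : C.T ∈ K ↔ C.F ∈ K) (hc : ∀ e ∈ constAxioms K, (ofCAlgebra c).Satisfies e)
    {s t : Term K} (h : ValidInC s t) (v : ℕ → A) :
    (ofCAlgebra c).eval v s = (ofCAlgebra c).eval v t := by
  simp only [forall_mem_constAxioms, satisfies_ax4a, satisfies_ax4b, satisfies_ax4c] at hc
  obtain ⟨hU, hT, hF⟩ := hc
  by_cases hTK : C.T ∈ K
  · let _ : BoundedCAlgebra A := { (‹_› : CAlgebra A) with top := c C.T, top_inf := hT hTK }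
    exact eval_eq_of_validInC_of_bounded (fun _ => rfl) (fun h => (hF hTK h).symm) hU h v
  · have h' := eval_eq_of_validInC_of_bounded (c := WithBounds.of ∘ c) (fun h => absurd h hTK)
      (fun h => absurd (hK.2 h) hTK) (fun h => congrArg WithBounds.of (hU h)) h
      (WithBounds.of ∘ v)
    rw [eval_withBounds_of, eval_withBounds_of] at h'
    exact WithBounds.of.inj h'

/-- Provable equality from `Γ`. -/
def derivesSetoid (Γ : Set (Equation K)) : Setoid (Term K) where
  r := Derives Γ
  iseqv := ⟨.refl, .symm, .trans⟩

/-- The Lindenbaum algebra of `Γ`: the terms modulo provable equality. The constants outside `K`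
are not denoted by a term, and are interpreted arbitrarily. -/
noncomputable def lindenbaum (Γ : Set (Equation K)) : Model (Quotient (derivesSetoid Γ)) where
  neg := Quotient.map _ fun _ _ => .neg
  and := Quotient.map₂ _ fun _ _ h₁ _ _ h₂ => .and h₁ h₂
  or := Quotient.map₂ _ fun _ _ h₁ _ _ h₂ => .or h₁ h₂
  const c := open Classical in if hc : c ∈ K then ⟦.const c hc⟧ else ⟦.var 0⟧

theorem eval_lindenbaum (Γ : Set (Equation K)) (σ : ℕ → Term K) (s : Term K) :
    (lindenbaum Γ).eval (fun n => ⟦σ n⟧) s = ⟦s.subst σ⟧ := by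
  induction s with
  | var n => rfl
  | const c hc => exact dif_pos hc
  | neg s ih => rw [Model.eval, ih]; rfl
  | and s t ihs iht | or s t ihs iht => rw [Model.eval, ihs, iht]; rfl

theorem lindenbaum_satisfies {Γ : Set (Equation K)} {e : Equation K} (he : e ∈ Γ) :
    (lindenbaum Γ).Satisfies e := by
  intro v
  obtain ⟨σ, rfl⟩ : ∃ σ : ℕ → Term K, v = fun n => ⟦σ n⟧ :=
    ⟨fun n => (v n).out, funext fun n => (v n).out_eq.symm⟩
  rw [eval_lindenbaum, eval_lindenbaum]
  exact Quotient.sound (.ax e he σ)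

theorem derives_of_lindenbaum_satisfies {Γ : Set (Equation K)} {s t : Term K}
    (h : (lindenbaum Γ).Satisfies ⟨s, t⟩) : Derives Γ s t := by
  have h_subst (r : Term K) : r.subst .var = r := by
    induction r with
    | var n => rfl
    | const c hc => rfl
    | neg r ih => rw [Term.subst, ih]
    | and r₁ r₂ ih₁ ih₂ | or r₁ r₂ ih₁ ih₂ => rw [Term.subst, ih₁, ih₂]
  have h := h fun n => ⟦.var n⟧
  rw [eval_lindenbaum, eval_lindenbaum, h_subst, h_subst] at h
  exact Quotient.exact h

theorem derives_of_validInC {Γ : Set (Equation K)} (hK : C.T ∈ K ↔ C.F ∈ K)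
    (hΓ : fiveAxioms K ⊆ Γ ∨ sixAxioms K ⊆ Γ) (hc : constAxioms K ⊆ Γ) {s t : Term K}
    (h : ValidInC s t) : Derives Γ s t := by
  apply derives_of_lindenbaum_satisfies
  rcases hΓ with hΓ | hΓ
  · let _ := (lindenbaum Γ).cAlgebra fun e he => lindenbaum_satisfies (hΓ he)
    exact Model.eval_eq_of_validInC (c := (lindenbaum Γ).const) hK
      (fun e he => lindenbaum_satisfies (hc he)) h
  · let _ := (lindenbaum Γ).distribCAlgebra fun e he => lindenbaum_satisfies (hΓ he)
    exact Model.eval_eq_of_validInC (c := (lindenbaum Γ).const) hK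
      (fun e he => lindenbaum_satisfies (hc he)) h

theorem forall_mem_fiveAxioms_union_constAxioms {p : Equation K → Prop} :
    (∀ e ∈ fiveAxioms K ∪ constAxioms K, p e) ↔
      p ax1a ∧ p ax1b ∧ p mem1 ∧ p ax1f ∧ p ax1g ∧
        (∀ hU, p (ax4a hU)) ∧ (∀ hT, p (ax4b hT)) ∧ ∀ hT hF, p (ax4c hT hF) := by
  simp only [fiveAxioms, Set.mem_union, Set.mem_insert_iff, Set.mem_singleton_iff, or_imp,
    forall_and, forall_eq, forall_mem_constAxioms, and_assoc]

theorem forall_mem_sixAxioms_union_constAxioms {p : Equation K → Prop} :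
    (∀ e ∈ sixAxioms K ∪ constAxioms K, p e) ↔
      p ax1a ∧ p ax1b ∧ p ax1d ∧ p mem2 ∧ p ax1f ∧ p ax1g ∧
        (∀ hU, p (ax4a hU)) ∧ (∀ hT, p (ax4b hT)) ∧ ∀ hT hF, p (ax4c hT hF) := by
  simp only [sixAxioms, Set.mem_union, Set.mem_insert_iff, Set.mem_singleton_iff, or_imp,
    forall_and, forall_eq, forall_mem_constAxioms, and_assoc]

theorem fiveAxioms_subset_guzmanSquier1_sdiff : fiveAxioms K ⊆ guzmanSquier1 K \ {ax1c} := by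
  rintro e (rfl | rfl | rfl | rfl | rfl) <;>
    simp [guzmanSquier1, ax1a, ax1b, ax1c, mem1, ax1f, ax1g, x, y, z]

theorem sixAxioms_subset_guzmanSquier2_sdiff : sixAxioms K ⊆ guzmanSquier2 K \ {ax1c} := by
  rintro e (rfl | rfl | rfl | rfl | rfl | rfl) <;>
    simp [guzmanSquier2, ax1a, ax1b, ax1c, ax1d, mem2, ax1f, ax1g, x, y, z]

theorem validInC_ax1c : ValidInC (ax1c : Equation K).lhs ax1c.rhs :=
  Model.standard_satisfies_iff.1 (Model.satisfies_ax1c.2 (CAlgebra.inf_assoc (A := C)))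

theorem standard_satisfies_of_mem {e : Equation K}
    (he : e ∈ guzmanSquier1 K ∪ guzmanSquier2 K ∪ constAxioms K) :
    Model.standard.Satisfies e := by
  rcases he with ((rfl | rfl | rfl | rfl | rfl | rfl | rfl) |
    (rfl | rfl | rfl | rfl | rfl | rfl | rfl)) | ⟨hU, rfl⟩ | ⟨hT, rfl⟩ | ⟨hT, hF, rfl⟩
  all_goals
    simp only [Model.satisfies_ax1a, Model.satisfies_ax1b, Model.satisfies_ax1c,
      Model.satisfies_ax1d, Model.satisfies_mem1, Model.satisfies_mem2, Model.satisfies_ax1f,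
      Model.satisfies_ax1g, Model.satisfies_ax4a, Model.satisfies_ax4b, Model.satisfies_ax4c]
    decide

theorem derives_union_constAxioms_iff (hK : C.T ∈ K ↔ C.F ∈ K) {Γ : Set (Equation K)}
    (hΓ : fiveAxioms K ⊆ Γ ∨ sixAxioms K ⊆ Γ) (hΓ' : Γ ⊆ guzmanSquier1 K ∪ guzmanSquier2 K)
    (s t : Term K) : Derives (Γ ∪ constAxioms K) s t ↔ ValidInC s t := by
  constructor
  · exact fun h => Model.standard_satisfies_iff.1 (Model.satisfies_of_derives
      (fun e he => standard_satisfies_of_mem (Set.union_subset_union_left _ hΓ' he)) h)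
  · exact derives_of_validInC hK (hΓ.imp (·.trans Set.subset_union_left)
      (·.trans Set.subset_union_left)) Set.subset_union_right

theorem completelyAxiomatisesCL_union_constAxioms (hK : C.T ∈ K ↔ C.F ∈ K)
    {Γ : Set (Equation K)} (hΓ : fiveAxioms K ⊆ Γ ∨ sixAxioms K ⊆ Γ)
    (hΓ' : Γ ⊆ guzmanSquier1 K ∪ guzmanSquier2 K) :
    CompletelyAxiomatisesCL (constAxioms K) (Γ ∪ constAxioms K) := by
  have h₁ := fiveAxioms_subset_guzmanSquier1_sdiff (K := K)
  have h₂ := sixAxioms_subset_guzmanSquier2_sdiff (K := K)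
  intro s t
  rw [derives_union_constAxioms_iff hK hΓ hΓ',
    derives_union_constAxioms_iff hK (.inl (h₁.trans Set.sdiff_subset)) Set.subset_union_left,
    derives_union_constAxioms_iff hK (.inr (h₂.trans Set.sdiff_subset)) Set.subset_union_right]
  exact ⟨.rfl, .rfl, .rfl⟩

theorem completelyAxiomatisesCL_fiveAxioms (hK : C.T ∈ K ↔ C.F ∈ K) :
    CompletelyAxiomatisesCL (constAxioms K) (fiveAxioms K ∪ constAxioms K) :=
  completelyAxiomatisesCL_union_constAxioms hK (.inl subset_rfl)
    (fiveAxioms_subset_guzmanSquier1_sdiff.trans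
      (Set.sdiff_subset.trans Set.subset_union_left))

theorem completelyAxiomatisesCL_sixAxioms (hK : C.T ∈ K ↔ C.F ∈ K) :
    CompletelyAxiomatisesCL (constAxioms K) (sixAxioms K ∪ constAxioms K) :=
  completelyAxiomatisesCL_union_constAxioms hK (.inr subset_rfl)
    (sixAxioms_subset_guzmanSquier2_sdiff.trans
      (Set.sdiff_subset.trans Set.subset_union_right))

theorem constAxioms_empty : constAxioms ∅ = ∅ := by
  ext e
  simp [constAxioms]

theorem constAxioms_constTF : constAxioms constTF = axiomsTF := by
  have hU : C.U ∉ constTF := by simp [constTF]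
  ext e
  simp [constAxioms, axiomsTF, T_mem_constTF, F_mem_constTF, hU]

theorem constAxioms_constU : constAxioms constU = axiomsU := by
  have hT : C.T ∉ constU := by simp [constU]
  ext e
  simp [constAxioms, axiomsU, U_mem_constU, hT]

theorem constAxioms_univ : constAxioms Set.univ = axiomsTFU := by
  ext e
  simp [constAxioms, axiomsTFU]

theorem not_independent_of_subset_sdiff {Γ : Set (Equation ∅)} (h_mem : ax1c ∈ Γ)
    (h : fiveAxioms ∅ ⊆ Γ \ {ax1c} ∨ sixAxioms ∅ ⊆ Γ \ {ax1c}) : ¬ Independent Γ :=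
  fun hi => hi ax1c h_mem
    (derives_of_validInC Iff.rfl h (constAxioms_empty.trans_subset (Set.empty_subset _))
      validInC_ax1c)

theorem not_independent_guzmanSquier1 : ¬ Independent (guzmanSquier1 ∅) :=
  not_independent_of_subset_sdiff (by simp [guzmanSquier1])
    (.inl fiveAxioms_subset_guzmanSquier1_sdiff)

theorem not_independent_guzmanSquier2 : ¬ Independent (guzmanSquier2 ∅) :=
  not_independent_of_subset_sdiff (by simp [guzmanSquier2])
    (.inr sixAxioms_subset_guzmanSquier2_sdiff)

theorem independent_of_models {Γ : Set (Equation K)}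
    (h : ∀ e ∈ Γ, ∃ (n : ℕ) (M : Model (Fin n)), ¬ M.Satisfies e ∧
      ∀ f ∈ Γ, f ≠ e → M.Satisfies f) : Independent Γ := by
  intro e he hd
  obtain ⟨n, M, hM, hΓ⟩ := h e he
  exact hM (Model.satisfies_of_derives (fun f hf => hΓ f hf.1 hf.2) hd)

namespace Model

/-- The interpretation of the constants `T`, `F`, `U` by three given elements. -/
def constants {A : Type*} (t f u : A) : C → A
  | C.T => t
  | C.F => f
  | C.U => u

/-- A model with constant negation. -/
def constNeg : Model (Fin 2) :=
  ⟨fun _ => 1, fun a b => if a = b then 1 else 0, fun a _ => a, constants 1 1 1⟩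

/-- The two-element group with trivial negation. -/
def group : Model (Fin 2) :=
  ⟨id, fun a b => a + b, fun a _ => a, constants 0 0 0⟩

/-- The three-element chain with `F < U < T`, that is, Kleene's strong three-valued logic. -/
def kleene : Model (Fin 3) :=
  ⟨Fin.rev, min, max, constants 2 0 1⟩

/-- The two-element semilattice with trivial negation. -/
def semilattice : Model (Fin 2) :=
  ⟨id, max, max, constants 0 0 1⟩

/-- Truth `3`, falsity `2` and two distinct undefined values. -/
def twoUndefined : Model (Fin 4) :=
  ⟨![0, 1, 3, 2], fun a b => if a = 3 then b else a, fun a b => if a = 2 then b else a,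
    constants 3 2 0⟩

/-- The operations of `C` on `T = 0`, `F = 1`, `U = 2`, with arbitrary constants. -/
def threeValued (t f u : Fin 3) : Model (Fin 3) :=
  ⟨![1, 0, 2], fun a b => if a = 0 then b else a, fun a b => if a = 1 then b else a,
    constants t f u⟩

/-- A model with nine elements in which conjunction does not distribute over disjunction. -/
def nonDistrib : Model (Fin 9) where
  neg := ![1, 0, 2, 4, 3, 6, 5, 8, 7]
  and a :=
    if a = 0 then id
    else if a = 3 then ![3, 4, 2, 3, 4, 7, 8, 7, 8]
    else if a = 5 then ![5, 6, 2, 7, 8, 5, 6, 7, 8]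
    else if a = 8 then ![8, 7, 2, 8, 7, 8, 7, 7, 8]
    else fun _ => a
  or a :=
    if a = 1 then id
    else if a = 4 then ![3, 4, 2, 3, 4, 7, 8, 7, 8]
    else if a = 6 then ![5, 6, 2, 7, 8, 5, 6, 7, 8]
    else if a = 7 then ![8, 7, 2, 8, 7, 8, 7, 7, 8]
    else fun _ => a
  const := constants 0 1 2

end Model

open Model in
theorem independent_fiveAxioms_union_constAxioms (K : Set C) :
    Independent (fiveAxioms K ∪ constAxioms K) := by
  refine independent_of_models ?_
  simp only [forall_mem_fiveAxioms_union_constAxioms]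
  refine ⟨⟨_, constNeg, ?_⟩, ⟨_, group, ?_⟩, ⟨_, kleene, ?_⟩, ⟨_, semilattice, ?_⟩,
    ⟨_, twoUndefined, ?_⟩, fun hU => ⟨_, threeValued 0 1 0, ?_⟩,
    fun hT => ⟨_, threeValued 2 2 2, ?_⟩, fun hT hF => ⟨_, threeValued 0 0 2, ?_⟩⟩ <;>
  and_intros <;> intros <;> first
  | contradiction
  | simp only [satisfies_ax1a, satisfies_ax1b, satisfies_mem1, satisfies_ax1f, satisfies_ax1g,
      satisfies_ax4a, satisfies_ax4b, satisfies_ax4c]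
    decide +kernel

open Model in
theorem independent_sixAxioms_union_constAxioms (K : Set C) :
    Independent (sixAxioms K ∪ constAxioms K) := by
  refine independent_of_models ?_
  simp only [forall_mem_sixAxioms_union_constAxioms]
  refine ⟨⟨_, constNeg, ?_⟩, ⟨_, group, ?_⟩, ⟨_, nonDistrib, ?_⟩, ⟨_, kleene, ?_⟩,
    ⟨_, semilattice, ?_⟩, ⟨_, twoUndefined, ?_⟩, fun hU => ⟨_, threeValued 0 1 0, ?_⟩,
    fun hT => ⟨_, threeValued 2 2 2, ?_⟩, fun hT hF => ⟨_, threeValued 0 0 2, ?_⟩⟩ <;>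
  and_intros <;> intros <;> first
  | contradiction
  | simp only [satisfies_ax1a, satisfies_ax1b, satisfies_ax1d, satisfies_mem2, satisfies_ax1f,
      satisfies_ax1g, satisfies_ax4a, satisfies_ax4b, satisfies_ax4c]
    decide +kernel

end CondLogic

theorem mainTheorem7 :
    -- the Guzmán–Squier axioms are not independent, under either reading of (1.1e)
    (¬ CondLogic.Independent (CondLogic.guzmanSquier1 ∅) ∧
      ¬ CondLogic.Independent (CondLogic.guzmanSquier2 ∅)) ∧
    -- (i) no distinguished constants, five axioms
    (CondLogic.CompletelyAxiomatisesCL ∅ (CondLogic.fiveAxioms ∅) ∧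
      CondLogic.Independent (CondLogic.fiveAxioms ∅)) ∧
    -- (ii) no distinguished constants, six axioms
    (CondLogic.CompletelyAxiomatisesCL ∅ (CondLogic.sixAxioms ∅) ∧
      CondLogic.Independent (CondLogic.sixAxioms ∅)) ∧
    -- (iii) only T and F distinguished
    ((CondLogic.CompletelyAxiomatisesCL CondLogic.axiomsTF
          (CondLogic.fiveAxioms CondLogic.constTF ∪ CondLogic.axiomsTF) ∧
        CondLogic.Independent (CondLogic.fiveAxioms CondLogic.constTF ∪ CondLogic.axiomsTF)) ∧
      (CondLogic.CompletelyAxiomatisesCL CondLogic.axiomsTF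
          (CondLogic.sixAxioms CondLogic.constTF ∪ CondLogic.axiomsTF) ∧
        CondLogic.Independent (CondLogic.sixAxioms CondLogic.constTF ∪ CondLogic.axiomsTF))) ∧
    -- (iv) only U distinguished
    ((CondLogic.CompletelyAxiomatisesCL CondLogic.axiomsU
          (CondLogic.fiveAxioms CondLogic.constU ∪ CondLogic.axiomsU) ∧
        CondLogic.Independent (CondLogic.fiveAxioms CondLogic.constU ∪ CondLogic.axiomsU)) ∧
      (CondLogic.CompletelyAxiomatisesCL CondLogic.axiomsU
          (CondLogic.sixAxioms CondLogic.constU ∪ CondLogic.axiomsU) ∧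
        CondLogic.Independent (CondLogic.sixAxioms CondLogic.constU ∪ CondLogic.axiomsU))) ∧
    -- (v) T, F and U distinguished
    ((CondLogic.CompletelyAxiomatisesCL CondLogic.axiomsTFU
          (CondLogic.fiveAxioms Set.univ ∪ CondLogic.axiomsTFU) ∧
        CondLogic.Independent (CondLogic.fiveAxioms Set.univ ∪ CondLogic.axiomsTFU)) ∧
      (CondLogic.CompletelyAxiomatisesCL CondLogic.axiomsTFU
          (CondLogic.sixAxioms Set.univ ∪ CondLogic.axiomsTFU) ∧
        CondLogic.Independent (CondLogic.sixAxioms Set.univ ∪ CondLogic.axiomsTFU))) := by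
  have h_five {K : Set CondLogic.C} (hK : CondLogic.C.T ∈ K ↔ CondLogic.C.F ∈ K) :=
    And.intro (CondLogic.completelyAxiomatisesCL_fiveAxioms hK)
      (CondLogic.independent_fiveAxioms_union_constAxioms K)
  have h_six {K : Set CondLogic.C} (hK : CondLogic.C.T ∈ K ↔ CondLogic.C.F ∈ K) :=
    And.intro (CondLogic.completelyAxiomatisesCL_sixAxioms hK)
      (CondLogic.independent_sixAxioms_union_constAxioms K)
  refine ⟨⟨CondLogic.not_independent_guzmanSquier1, CondLogic.not_independent_guzmanSquier2⟩,
    ?_, ?_, ?_, ?_, ?_⟩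
  · simpa only [CondLogic.constAxioms_empty, Set.union_empty] using h_five (K := ∅) Iff.rfl
  · simpa only [CondLogic.constAxioms_empty, Set.union_empty] using h_six (K := ∅) Iff.rfl
  · have hK := iff_of_true CondLogic.T_mem_constTF CondLogic.F_mem_constTF
    simpa only [CondLogic.constAxioms_constTF] using And.intro (h_five hK) (h_six hK)
  · have hK : CondLogic.C.T ∈ CondLogic.constU ↔ CondLogic.C.F ∈ CondLogic.constU :=
      iff_of_false nofun nofun
    simpa only [CondLogic.constAxioms_constU] using And.intro (h_five hK) (h_six hK)
  · have hK := iff_of_true (Set.mem_univ CondLogic.C.T) (Set.mem_univ CondLogic.C.F)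
    simpa only [CondLogic.constAxioms_univ] using And.intro (h_five hK) (h_six hK)
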